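/- Let $R$ be a complete regular (Noetherian) local ring with maximal ideal $\mathfrak m$ and residue characteristic different from $2$, let $\pi\in\mathfrak m\setminus\mathfrak m^2$, and let $n,k\ge 0$. Then the pair $(G,H)=\bigl((\mathrm{GL}_{n+k})_R,\ (\mathrm{GL}_n)_R\times(\mathrm{GL}_k)_R\bigr)$, where $H\subset G$ is the closed subgroup scheme of block diagonal matrices, is uniform spherical in the following sense. An $(R,\pi)$-local field is a non-Archimedean local field $F$ together with a surjective ring homomorphism $R\to O_F$ that sends $\pi$ to a uniformizer; we still write $\pi$ for its image, $val_F$ for the normalized valuation, $\mathfrak m_F$ for the maximal ideal of $O_F$, $K_0(F)=G(O_F)$, and $K_\ell(F)=\ker\bigl(G(O_F)\to G(O_F/\mathfrak m_F^\ell)\bigr)$. For a split torus $T\subset G$ over $R$ and a coweight $\alpha\in X_*(T)$ put $\pi^\alpha=\alpha(\pi)\in T(R[\pi^{-1}])$. That $(G,H)$ is uniform spherical means that there exist - a split torus $T\subset G$ over $R$, - a closed embedding over $R$ of the (fppf) quotient $G/H$ into an affine space $\mathbb A^d_R$, - a finite subset $\mathfrak X\subset G(R)/H(R)$, and - a subset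 $\Upsilon\subset X_*(T)$, such that, with $\pi^\Upsilon\mathfrak X=\{\pi^\alpha\xi : \alpha\in\Upsilon,\ \xi\in\mathfrak X\}\subset G(R[\pi^{-1}])/H(R[\pi^{-1}])\subset (G/H)(R[\pi^{-1}])$: 1. for every $(R,\pi)$-local field $F$, the map $x\mapsto K_0(F)x$ from $\pi^\Upsilon\mathfrak X$ to $K_0(F)\backslash G(F)/H(F)$ is onto; 2. for all $x,y\in\pi^\Upsilon\mathfrak X$, the schematic closure in $G$ of the closed subscheme $T_{x,y}=\{g : gx=y\}$ of $G\times_{\mathrm{Spec}\,R}\mathrm{Spec}\,R[\pi^{-1}]$ is smooth over $R$; 3. for every $x\in\pi^\Upsilon\mathfrak X$, the valuation $val_F(x)=\min_j val_F(x_j)$, where $x_1,\dots,x_d\in F$ are the coordinates of $x$ in $\mathbb A^d(F)$, is the same for all $(R,\pi)$-local fields $F$; 4. there is $\ell_0$ such that for all $\ell>\ell_0$, all $(R,\pi)$-local fields $F$, all $\xi\in\mathfrak X$ and all $\alpha\in\Upsilon$, one has $K_\ell(F)\,\pi^\alpha K_\ell(F)\,\xi=K_\ell(F)\,\pi^\alpha\,\xi$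 in $G(F)/H(F)$. -/

import Mathlib

open ValuativeRel

universe u

noncomputable section

/-- An affine group scheme over `R`: a functor from commutative `R`-algebras to groups (its functor
of points) together with a coordinate ring `coord` and a universal point `gen` in `Pt coord`
representing it. -/
structure AffGrpScheme (R : Type u) [CommRing R] where
  /-- The points with values in an `R`-algebra. -/
  Pt : (S : Type u) → [CommRing S] → [Algebra R S] → Type u
  [group : ∀ (S : Type u) [CommRing S] [Algebra R S], Group (Pt S)]
  /-- Functoriality. -/
  map : ∀ {S T : Type u} [CommRing S] [Algebra R S] [CommRing T] [Algebra R T],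
    (S →ₐ[R] T) → (Pt S →* Pt T)
  map_id : ∀ {S : Type u} [CommRing S] [Algebra R S] (g : Pt S), map (AlgHom.id R S) g = g
  map_comp : ∀ {S T U : Type u} [CommRing S] [Algebra R S] [CommRing T] [Algebra R T]
    [CommRing U] [Algebra R U] (f : S →ₐ[R] T) (f' : T →ₐ[R] U) (g : Pt S),
    map (f'.comp f) g = map f' (map f g)
  /-- The coordinate ring. -/
  coord : Type u
  [commRing : CommRing coord]
  [algebra : Algebra R coord]
  /-- The universal point. -/
  gen : Pt coord
  existsUnique_ev : ∀ {S : Type u} [CommRing S] [Algebra R S] (g : Pt S),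
    ∃! f : coord →ₐ[R] S, map f gen = g

attribute [instance] AffGrpScheme.group AffGrpScheme.commRing AffGrpScheme.algebra

namespace AffGrpScheme

variable {R : Type u} [CommRing R]

/-- Evaluation of regular functions at a point. -/
def ev (G : AffGrpScheme R) {S : Type u} [CommRing S] [Algebra R S] (g : G.Pt S) :
    G.coord →ₐ[R] S :=
  (G.existsUnique_ev g).choose

lemma map_ev_gen (G : AffGrpScheme R) {S : Type u} [CommRing S] [Algebra R S] (g : G.Pt S) :
    G.map (G.ev g) G.gen = g :=
  (G.existsUnique_ev g).choose_spec.1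

lemma ev_unique (G : AffGrpScheme R) {S : Type u} [CommRing S] [Algebra R S] (g : G.Pt S)
    (f : G.coord →ₐ[R] S) (hf : G.map f G.gen = g) : f = G.ev g :=
  (G.existsUnique_ev g).choose_spec.2 f hf

/-- Homomorphisms of affine group schemes. -/
structure Hom (H G : AffGrpScheme R) where
  toHom : ∀ (S : Type u) [CommRing S] [Algebra R S], H.Pt S →* G.Pt S
  naturality : ∀ {S T : Type u} [CommRing S] [Algebra R S] [CommRing T] [Algebra R T]
    (f : S →ₐ[R] T) (h : H.Pt S), toHom T (H.map f h) = G.map f (toHom S h)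

/-- The homomorphism induced on coordinate rings. -/
def Hom.comap {H G : AffGrpScheme R} (i : Hom H G) : G.coord →ₐ[R] H.coord :=
  G.ev (i.toHom H.coord H.gen)

/-- `i` identifies `H` with a closed subgroup scheme of `G`. -/
def Hom.IsClosedImmersion {H G : AffGrpScheme R} (i : Hom H G) : Prop :=
  Function.Surjective i.comap

/-! ### The group schemes `GL`, products, split tori -/

lemma existsUnique_algHom_away {σ : Type} {S : Type u} [CommRing S] [Algebra R S]
    (d : MvPolynomial σ R) (v : σ → S) (hv : IsUnit (MvPolynomial.aeval v d)) :
    ∃! f : Localization.Away d →ₐ[R] S,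
      ∀ s, f (algebraMap (MvPolynomial σ R) _ (MvPolynomial.X s)) = v s := by
  have hu : ∀ y : Submonoid.powers d, IsUnit (MvPolynomial.aeval (R := R) v y) := by
    rintro ⟨_, m, rfl⟩
    simpa using hv.pow m
  refine ⟨IsLocalization.liftAlgHom (M := Submonoid.powers d) hu, fun s => ?_, fun f hf => ?_⟩
  · simp
  · apply IsLocalization.algHom_ext (Submonoid.powers d)
    apply MvPolynomial.algHom_ext
    intro s
    simp [hf, Algebra.algHom]

section GeneralLinear

variable (R) (ι : Type) [Fintype ι] [DecidableEq ι]

/-- The coordinate ring of `GL`: polynomials in the matrix entries with `det` inverted. -/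
abbrev GLCoord : Type u := Localization.Away (Matrix.mvPolynomialX ι ι R).det

/-- The general linear group scheme over `R`, with rows and columns indexed by `ι`. -/
def GLScheme : AffGrpScheme R where
  Pt S _ _ := Matrix.GeneralLinearGroup ι S
  map f := Matrix.GeneralLinearGroup.map f.toRingHom
  map_id g := by ext; simp
  map_comp f f' g := by ext; simp
  coord := GLCoord R ι
  gen := Matrix.GeneralLinearGroup.mk''
    ((Matrix.mvPolynomialX ι ι R).map (algebraMap _ (GLCoord R ι))) (by
      rw [← RingHom.mapMatrix_apply, ← RingHom.map_det]
      exact IsLocalization.Away.algebraMap_isUnit _)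
  existsUnique_ev {S} _ _ g := by
    have hd : MvPolynomial.aeval (fun p : ι × ι => g.1 p.1 p.2)
        (Matrix.mvPolynomialX ι ι R).det = g.1.det := by
      rw [AlgHom.map_det, Matrix.mvPolynomialX_mapMatrix_aeval]
    obtain ⟨f, hf, hu⟩ := existsUnique_algHom_away (R := R)
      (Matrix.mvPolynomialX ι ι R).det (fun p : ι × ι => g.1 p.1 p.2)
      (by rw [hd]; exact (Matrix.isUnit_iff_isUnit_det _).1 g.isUnit)
    refine ⟨f, ?_, fun f' hf' => hu f' ?_⟩
    · ext a b
      exact hf (a, b)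
    · rintro ⟨a, b⟩
      rw [← hf']
      rfl

end GeneralLinear

open scoped TensorProduct in
/-- The product of two affine group schemes. -/
def prod (G H : AffGrpScheme R) : AffGrpScheme R where
  Pt S _ _ := G.Pt S × H.Pt S
  map f := (G.map f).prodMap (H.map f)
  map_id g := by ext <;> simp [map_id]
  map_comp f f' g := by ext <;> simp [map_comp]
  coord := G.coord ⊗[R] H.coord
  gen := (G.map Algebra.TensorProduct.includeLeft G.gen,
    H.map Algebra.TensorProduct.includeRight H.gen)
  existsUnique_ev {S} _ _ g := by
    refine ⟨Algebra.TensorProduct.lift (G.ev g.1) (H.ev g.2) fun _ _ => Commute.all _ _, ?_, ?_⟩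
    · ext
      · simp [← map_comp, map_ev_gen]
      · simp [← map_comp, map_ev_gen]
    · intro f hf
      apply Algebra.TensorProduct.ext
      · rw [Algebra.TensorProduct.lift_comp_includeLeft]
        exact G.ev_unique _ _ (by rw [map_comp]; exact congrArg Prod.fst hf)
      · rw [Algebra.TensorProduct.lift_comp_includeRight]
        exact H.ev_unique _ _ (by rw [map_comp]; exact congrArg Prod.snd hf)

/-- The split torus of rank `r` over `R`. Its coweight lattice is `Fin r → ℤ`, the coweight `α`
being the cocharacter `t ↦ (t ^ α 0, …, t ^ α (r - 1))`. -/
def torus (R : Type u) [CommRing R] (r : ℕ) : AffGrpScheme R where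
  Pt S _ _ := Fin r → Sˣ
  map f := { toFun := fun t i => Units.map f.toRingHom.toMonoidHom (t i)
             map_one' := by ext; simp
             map_mul' := fun _ _ => by ext; simp }
  map_id g := by ext; simp
  map_comp f f' g := by ext; simp
  coord := Localization.Away (∏ i : Fin r, MvPolynomial.X (R := R) i)
  gen := fun i => IsUnit.unit (a := algebraMap _ _ (MvPolynomial.X (R := R) i)) (by
    have h := IsLocalization.Away.algebraMap_isUnit
      (S := Localization.Away (∏ i : Fin r, MvPolynomial.X (R := R) i))
      (∏ i : Fin r, MvPolynomial.X (R := R) i)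
    rw [map_prod, IsUnit.prod_univ_iff] at h
    exact h i)
  existsUnique_ev {S} _ _ g := by
    obtain ⟨f, hf, hu⟩ := existsUnique_algHom_away (R := R)
      (∏ i : Fin r, MvPolynomial.X (R := R) i) (fun i => (g i : S))
      (by simp)
    refine ⟨f, ?_, fun f' hf' => hu f' ?_⟩
    · ext i
      exact hf i
    · intro i
      rw [← hf']
      rfl

/-- The inclusion `GL_n × GL_k → GL_{n+k}` as block diagonal matrices; the rows and columns of
`GL_{n+k}` are indexed by `Fin n ⊕ Fin k`. -/
def blockDiag (R : Type u) [CommRing R] (n k : ℕ) :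
    Hom ((GLScheme R (Fin n)).prod (GLScheme R (Fin k))) (GLScheme R (Fin n ⊕ Fin k)) where
  toHom S _ _ :=
    { toFun := fun g =>
        { val := Matrix.fromBlocks g.1.1 0 0 g.2.1
          inv := Matrix.fromBlocks g.1⁻¹.1 0 0 g.2⁻¹.1
          val_inv := by
            simp only [Matrix.fromBlocks_multiply, Matrix.mul_zero, Matrix.zero_mul, add_zero,
              zero_add]
            rw [show g.1.1 * (g.1⁻¹).1 = 1 from g.1.mul_inv,
              show g.2.1 * (g.2⁻¹).1 = 1 from g.2.mul_inv, Matrix.fromBlocks_one]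
          inv_val := by
            simp only [Matrix.fromBlocks_multiply, Matrix.mul_zero, Matrix.zero_mul, add_zero,
              zero_add]
            rw [show (g.1⁻¹).1 * g.1.1 = 1 from g.1.inv_mul,
              show (g.2⁻¹).1 * g.2.1 = 1 from g.2.inv_mul, Matrix.fromBlocks_one] }
      map_one' := Units.ext Matrix.fromBlocks_one
      map_mul' := fun a b => Units.ext (by
        show Matrix.fromBlocks (a.1.1 * b.1.1) 0 0 (a.2.1 * b.2.1) =
          Matrix.fromBlocks a.1.1 0 0 a.2.1 * Matrix.fromBlocks b.1.1 0 0 b.2.1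
        simp [Matrix.fromBlocks_multiply]) }
  naturality {S T} _ _ _ _ f h := Units.ext (by
    show Matrix.fromBlocks (h.1.1.map f) 0 0 (h.2.1.map f) =
      (Matrix.fromBlocks h.1.1 0 0 h.2.1).map f
    simp [Matrix.fromBlocks_map])

/-! ### Cosets and the embedded quotient -/

section Quotient

variable {H G : AffGrpScheme R} (i : Hom H G)

/-- The coset space `G(S)/H(S)`. -/
abbrev Coset (S : Type u) [CommRing S] [Algebra R S] : Type u := G.Pt S ⧸ (i.toHom S).range

/-- Functoriality of `S ↦ G(S)/H(S)`. -/
def Coset.map {S T : Type u} [CommRing S] [Algebra R S] [CommRing T] [Algebra R T]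
    (f : S →ₐ[R] T) : Coset i S → Coset i T :=
  Quotient.map' (G.map f) (by
    intro a b hab
    rw [QuotientGroup.leftRel_apply] at hab ⊢
    obtain ⟨h, hh⟩ := hab
    exact ⟨H.map f h, by rw [i.naturality, hh, map_mul, map_inv]⟩)

/-- A closed embedding over `R` of the quotient `G/H` into the affine space of dimension `d`. It is
given by regular functions `φ 0, …, φ (d - 1)` on `G`. The closed subscheme of affine space cut out
by all polynomial relations between them has to be the quotient of `G` by `H` for the fppf topology:
two points of `G` have the same image if and only if they lie in the same coset of `H`, and every
point of the subscheme lifts to `G` locally for the fppf topology. -/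
structure QuotientEmbedding (d : ℕ) where
  φ : Fin d → G.coord
  eq_iff : ∀ (S : Type u) [CommRing S] [Algebra R S] (g g' : G.Pt S),
    (∀ j, G.ev g (φ j) = G.ev g' (φ j)) ↔ g⁻¹ * g' ∈ (i.toHom S).range
  exists_lift : ∀ (S : Type u) [CommRing S] [Algebra R S] (x : Fin d → S),
    (∀ p : MvPolynomial (Fin d) R, MvPolynomial.aeval φ p = 0 → MvPolynomial.aeval x p = 0) →
    ∃ (S' : Type u) (_ : CommRing S') (_ : Algebra R S') (_ : Algebra S S')
      (_ : IsScalarTower R S S'),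
      Module.FaithfullyFlat S S' ∧ Algebra.FinitePresentation S S' ∧
        ∃ g : G.Pt S', ∀ j, G.ev g (φ j) = algebraMap S S' (x j)

/-- The coordinates in affine space of a point of `G(S)/H(S)`. -/
def QuotientEmbedding.coords {i : Hom H G} {d : ℕ} (e : QuotientEmbedding i d)
    {S : Type u} [CommRing S] [Algebra R S] : Coset i S → Fin d → S :=
  Quotient.lift (fun g j => G.ev g (e.φ j)) (by
    intro a b hab
    funext j
    exact (e.eq_iff S a b).2 (QuotientGroup.leftRel_apply.1 hab) j)

end Quotient

end AffGrpScheme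

/-! ### Local fields over `(R, π)` -/

/-- An `(R, π)`-local field: a nonarchimedean local field `F` with a surjective ring homomorphism
from `R` to its ring of integers which maps `π` to a uniformizer. -/
structure RelLocalField (R : Type u) [CommRing R] (π : R) where
  F : Type u
  [field : Field F]
  [valuativeRel : ValuativeRel F]
  [topologicalSpace : TopologicalSpace F]
  [isLocalField : IsNonarchimedeanLocalField F]
  toInt : R →+* 𝒪[F]
  surjective : Function.Surjective toInt
  irreducible : Irreducible (toInt π)

namespace RelLocalField

attribute [instance] field valuativeRel topologicalSpace isLocalField

variable {R : Type u} [CommRing R] {π : R} (E : RelLocalField R π)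

/-- The ring of integers. -/
abbrev O : Type u := 𝒪[E.F]

instance : Algebra R E.O := E.toInt.toAlgebra

instance : Algebra R E.F := ((algebraMap E.O E.F).comp E.toInt).toAlgebra

instance : IsScalarTower R E.O E.F := IsScalarTower.of_algebraMap_eq fun _ => rfl

/-- The normalized additive valuation, with value `⊤` at `0`. -/
def val (x : E.F) : WithTop ℤ :=
  open scoped Classical in
  if x = 0 then ⊤
  else ((-WithZero.log (IsNonarchimedeanLocalField.valueGroupWithZeroIsoInt E.F
    (valuation E.F x)) : ℤ) : WithTop ℤ)

/-- The minimum of the valuations of the coordinates. -/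
def valMin {d : ℕ} (x : Fin d → E.F) : WithTop ℤ := Finset.univ.inf fun j => E.val (x j)

lemma isUnit_algebraMap : IsUnit (algebraMap R E.F π) := by
  rw [isUnit_iff_ne_zero]
  intro h
  exact E.irreducible.ne_zero (Subtype.ext h)

/-- The map from `R[π⁻¹]` to `F`. -/
def ofAway : Localization.Away π →ₐ[R] E.F :=
  IsLocalization.liftAlgHom (M := Submonoid.powers π) (f := Algebra.ofId R E.F) (by
    rintro ⟨_, m, rfl⟩
    simpa [Algebra.ofId_apply] using E.isUnit_algebraMap.pow m)

/-- The subgroup `K_0 = G(O_F)` of `G(F)`. -/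
def K₀ (G : AffGrpScheme R) : Subgroup (G.Pt E.F) :=
  (G.map (IsScalarTower.toAlgHom R E.O E.F)).range

/-- The congruence subgroup `K_l`: the kernel of `G(O_F) → G(O_F / 𝓂 ^ l)`, inside `G(F)`. -/
def K (G : AffGrpScheme R) (l : ℕ) : Subgroup (G.Pt E.F) :=
  (G.map (Ideal.Quotient.mkₐ R ((IsLocalRing.maximalIdeal E.O) ^ l))).ker.map
    (G.map (IsScalarTower.toAlgHom R E.O E.F))

end RelLocalField

/-! ### Uniform spherical pairs -/

namespace AffGrpScheme

variable {R : Type u} [CommRing R] {H G : AffGrpScheme R}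

/-- `π ^ α`, for a coweight `α` of a split torus mapping to `G`, as a point over `R[π⁻¹]`. -/
def piPow (π : R) {r : ℕ} (τ : Hom (torus R r) G) (α : Fin r → ℤ) : G.Pt (Localization.Away π) :=
  τ.toHom (Localization.Away π) fun j =>
    (IsLocalization.Away.algebraMap_isUnit (S := Localization.Away π) π).unit ^ α j

/-- The subset `π^Υ 𝔛` of `(G/H)(R[π⁻¹])`. -/
def piPoints (π : R) (i : Hom H G) {r : ℕ} (τ : Hom (torus R r) G)
    (𝔛 : Set (Coset i R)) (Υ : Set (Fin r → ℤ)) : Set (Coset i (Localization.Away π)) :=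
  {x | ∃ α ∈ Υ, ∃ ξ ∈ 𝔛, x = piPow π τ α • Coset.map i (Algebra.ofId R (Localization.Away π)) ξ}

/-- The ideal of the schematic closure in `G` of the closed subscheme
`T_{x,y} = {g | g x = y}` of the base change of `G` to `R[π⁻¹]`: the ideal of all regular functions
on `G` that vanish on `T_{x,y}`, that is, at all points of `T_{x,y}` with values in
`R[π⁻¹]`-algebras. -/
def closureIdeal (π : R) (i : Hom H G) (x y : Coset i (Localization.Away π)) : Ideal G.coord where
  carrier := {f | ∀ (S : Type u) [CommRing S] [Algebra R S] (ρ : Localization.Away π →ₐ[R] S)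
    (g : G.Pt S), g • Coset.map i ρ x = Coset.map i ρ y → G.ev g f = 0}
  zero_mem' := fun S _ _ ρ g _ => map_zero _
  add_mem' := fun {a b} ha hb S _ _ ρ g hg => by rw [map_add, ha S ρ g hg, hb S ρ g hg, add_zero]
  smul_mem' := fun c a ha S _ _ ρ g hg => by rw [smul_eq_mul, map_mul, ha S ρ g hg, mul_zero]

/-- The pair `(G, H)` of affine group schemes over `R`, with `H` a subgroup of `G` via `i`, is
uniform spherical (with respect to the element `π` of `R`). -/
def IsUniformSpherical (π : R) (i : Hom H G) : Prop :=
  i.IsClosedImmersion ∧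
  -- a split torus `T` in `G`, an embedding of `G/H`, the sets `𝔛` and `Υ`
  ∃ (r : ℕ) (τ : Hom (torus R r) G) (d : ℕ) (e : QuotientEmbedding i d)
    (𝔛 : Set (Coset i R)) (Υ : Set (Fin r → ℤ)),
    τ.IsClosedImmersion ∧ 𝔛.Finite ∧
    -- `π^Υ 𝔛 → K_0 \ G(F) / H(F)` is onto
    (∀ (E : RelLocalField R π) (z : Coset i E.F), ∃ x ∈ piPoints π i τ 𝔛 Υ,
      ∃ c ∈ E.K₀ G, z = c • Coset.map i E.ofAway x) ∧
    -- the closures `S_{x,y}` are smooth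
    (∀ x ∈ piPoints π i τ 𝔛 Υ, ∀ y ∈ piPoints π i τ 𝔛 Υ,
      Algebra.Smooth R (G.coord ⧸ closureIdeal π i x y)) ∧
    -- the valuations do not depend on the field
    (∀ x ∈ piPoints π i τ 𝔛 Υ, ∀ E E' : RelLocalField R π,
      E.valMin (e.coords (Coset.map i E.ofAway x)) =
        E'.valMin (e.coords (Coset.map i E'.ofAway x))) ∧
    -- `K_l π^α K_l x = K_l π^α x`
    (∃ l₀ : ℕ, ∀ l > l₀, ∀ E : RelLocalField R π, ∀ ξ ∈ 𝔛, ∀ α ∈ Υ,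
      {z : Coset i E.F | ∃ c ∈ E.K G l, ∃ c' ∈ E.K G l,
        z = (c * G.map E.ofAway (piPow π τ α) * c') • Coset.map i (Algebra.ofId R E.F) ξ} =
      {z : Coset i E.F | ∃ c ∈ E.K G l,
        z = (c * G.map E.ofAway (piPow π τ α)) • Coset.map i (Algebra.ofId R E.F) ξ})

end AffGrpScheme

end

/-! Write `P` for the `n × k` matrix with ones at the positions `(i, i)`, `s` for the unipotent
block matrix with rows `(1, P)` and `(0, 1)`, and `δ_a = diag(1, π ^ a)` with `a : Fin k → ℕ`. The
data are: `T` the diagonal torus of the second block, `𝔛 = {sH}`, and `Υ` the set of all `a ≥ 0`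
with `a j = 0` for `j ≥ n`. The quotient is embedded as the variety of idempotents of rank `n`, by
`g ↦ g diag(1, 0) g⁻¹`.

Double cosets: elimination over `O_F` makes `g` block upper triangular, so modulo `H` it is a shear
by some `W`. Integral row and column operations diagonalize `W`, and integral summands are absorbed
by `K_0`; every diagonal entry can thus be normalized to `π ^ (-a j)`, which is the shear conjugate
to `s` under `δ_a` (`exists_eq_integral_mul_representative_mul_diag`).

Smoothness: the condition `g x_a = x_b`, for `x_a = δ_a s H`, says that the lower left block
vanishes and gives one equation for each pair `(i, j)`, linear in the entries of `g`. Divided by the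
smaller power of `π`, it expresses one entry of a diagonal block through other entries, and no entry
is solved for twice. The resulting scheme is a principal open subset of affine space. It is flat
over `R`, and `π` is a nonzerodivisor because a regular local ring is a domain, so it is the
schematic closure (`closureIdeal_stdPt`).

Valuations: the idempotent of `δ_a s` has entries `0`, `1` and `-π ^ (-a j)`.

Congruence subgroups: `c ∈ K_l` is a lower shear, which `δ_a` contracts, times a block upper
triangular factor; the latter moves `s` modulo `H` only by elements of `K_l` commuting with `δ_a`
(`exists_congruent_mul_representative_mul_diag`). -/

noncomputable section


/-! ### Regular local rings are domains -/

section RegularLocalRing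

open IsLocalRing

/-- The class of `x` in the cotangent space is nonzero, so it extends to a basis; lifts of the other
basis vectors generate together with `x`, by Nakayama. -/
lemma IsLocalRing.exists_maximalIdeal_le_span_insert {R : Type*} [CommRing R] [IsLocalRing R]
    [IsNoetherianRing R] {x : R} (hx : x ∈ maximalIdeal R) (hx2 : x ∉ maximalIdeal R ^ 2) :
    ∃ y : Fin ((maximalIdeal R).spanFinrank - 1) → R,
      (∀ i, y i ∈ maximalIdeal R) ∧
      maximalIdeal R ≤ Ideal.span {x} ⊔ Ideal.span (Set.range y) := by
  set V := CotangentSpace R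
  set v : V := (maximalIdeal R).toCotangent ⟨x, hx⟩
  have hv : v ≠ 0 := fun h => hx2 (by simpa using ((maximalIdeal R).toCotangent_eq_zero _).1 h)
  set W : Submodule (ResidueField R) V := Submodule.span _ {v}
  have hW : Module.finrank (ResidueField R) (V ⧸ W) = (maximalIdeal R).spanFinrank - 1 := by
    have h1 := Submodule.finrank_quotient_add_finrank W
    rw [finrank_span_singleton hv] at h1
    rw [spanFinrank_maximalIdeal_eq_finrank_cotangentSpace]
    exact Nat.eq_sub_of_add_eq h1
  let b := (Module.finBasis (ResidueField R) (V ⧸ W)).reindex (finCongr hW)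
  have hlift : ∀ i, ∃ y : maximalIdeal R, W.mkQ ((maximalIdeal R).toCotangent y) = b i := by
    intro i
    obtain ⟨u, hu⟩ := W.mkQ_surjective (b i)
    obtain ⟨y, rfl⟩ := (maximalIdeal R).toCotangent_surjective u
    exact ⟨y, hu⟩
  choose y hy using hlift
  refine ⟨fun i => y i, fun i => (y i).2, ?_⟩
  set J := Ideal.span {x} ⊔ Ideal.span (Set.range fun i => (y i : R))
  refine Submodule.le_of_le_smul_of_le_jacobson_bot (I := maximalIdeal R) (N := J)
    (IsNoetherian.noetherian _) (maximalIdeal_le_jacobson _) ?_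
  intro u hu
  have h1 := b.sum_repr (W.mkQ ((maximalIdeal R).toCotangent ⟨u, hu⟩))
  choose c hc using fun i => IsLocalRing.residue_surjective
    (b.repr (W.mkQ ((maximalIdeal R).toCotangent ⟨u, hu⟩)) i)
  have h2 : (maximalIdeal R).toCotangent ⟨u, hu⟩ -
      (maximalIdeal R).toCotangent (∑ i, c i • y i) ∈ W := by
    rw [← Submodule.ker_mkQ W, LinearMap.mem_ker, map_sub, ← h1, sub_eq_zero, map_sum, map_sum]
    refine Finset.sum_congr rfl fun i _ => ?_
    rw [← hc, map_smul, ← hy, ← map_smul]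
    rfl
  obtain ⟨d, hd⟩ := Submodule.mem_span_singleton.1 h2
  obtain ⟨d, rfl⟩ := IsLocalRing.residue_surjective d
  have h3 : (maximalIdeal R).toCotangent (⟨u, hu⟩ - ∑ i, c i • y i - d • ⟨x, hx⟩) = 0 := by
    rw [map_sub, map_sub, ← hd, map_smul, sub_eq_zero]
    rfl
  rw [Ideal.toCotangent_eq_zero] at h3
  have h4 : u = (∑ i, c i * (y i : R) + d * x) +
      ((⟨u, hu⟩ - ∑ i, c i • y i - d • ⟨x, hx⟩ : maximalIdeal R) : R) := by
    simp
  rw [h4]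
  refine Submodule.add_mem_sup (J.add_mem (J.sum_mem fun i _ => J.mul_mem_left _ ?_)
    (J.mul_mem_left _ ?_)) ?_
  · exact Ideal.mem_sup_right (Ideal.subset_span ⟨i, rfl⟩)
  · exact Ideal.mem_sup_left (Ideal.mem_span_singleton_self x)
  · rwa [smul_eq_mul, ← pow_two]

/-- Dividing by `x` lowers the number of generators of the maximal ideal by at least one and the
dimension by at most one, so the two numbers still agree. -/
lemma IsRegularLocalRing.quotient_span_singleton {R : Type*} [CommRing R] [IsRegularLocalRing R]
    {x : R} (hx : x ∈ maximalIdeal R) (hx2 : x ∉ maximalIdeal R ^ 2) :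
    ∃ _ : IsRegularLocalRing (R ⧸ Ideal.span {x}),
      (maximalIdeal (R ⧸ Ideal.span {x})).spanFinrank + 1 ≤ (maximalIdeal R).spanFinrank := by
  have hle : Ideal.span {x} ≤ maximalIdeal R := (Ideal.span_singleton_le_iff_mem _).2 hx
  have : Nontrivial (R ⧸ Ideal.span {x}) :=
    Ideal.Quotient.nontrivial_iff.2 fun h => (maximalIdeal.isMaximal R).ne_top (top_le_iff.1 (h ▸ hle))
  have : IsLocalRing (R ⧸ Ideal.span {x}) :=
    IsLocalRing.of_surjective' (Ideal.Quotient.mk _) Ideal.Quotient.mk_surjective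
  obtain ⟨y, hy, hspan⟩ := IsLocalRing.exists_maximalIdeal_le_span_insert hx hx2
  have hpos : (maximalIdeal R).spanFinrank ≠ 0 := by
    intro h
    rw [Submodule.spanFinrank_eq_zero_iff_eq_bot (IsNoetherian.noetherian _)] at h
    apply hx2
    rw [h, Ideal.mem_bot] at hx
    simp [hx]
  have hmax : maximalIdeal (R ⧸ Ideal.span {x}) =
      Ideal.span (Set.range fun i => Ideal.Quotient.mk (Ideal.span {x}) (y i)) := by
    apply le_antisymm
    · intro u hu
      obtain ⟨u, rfl⟩ := Ideal.Quotient.mk_surjective u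
      have hu' : u ∈ maximalIdeal R := fun h => hu (h.map _)
      have := Ideal.mem_map_of_mem (Ideal.Quotient.mk (Ideal.span {x})) (hspan hu')
      rw [Ideal.map_sup, Ideal.map_quotient_self, bot_sup_eq, Ideal.map_span, ← Set.range_comp]
        at this
      exact this
    · rw [Ideal.span_le]
      rintro _ ⟨i, rfl⟩ h
      refine hy i ?_
      obtain ⟨w, hw⟩ := h.exists_right_inv
      obtain ⟨w, rfl⟩ := Ideal.Quotient.mk_surjective w
      rw [← map_mul, ← map_one (Ideal.Quotient.mk _), Ideal.Quotient.eq] at hw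
      have h1 : y i * w ∉ maximalIdeal R := fun h =>
        (maximalIdeal.isMaximal R).ne_top ((Ideal.eq_top_iff_one _).2
          (by simpa using (maximalIdeal R).sub_mem h (hle hw)))
      exact isUnit_of_mul_isUnit_left (not_not.1 h1)
  have hrank : (maximalIdeal (R ⧸ Ideal.span {x})).spanFinrank + 1 ≤
      (maximalIdeal R).spanFinrank := by
    have h1 : (maximalIdeal (R ⧸ Ideal.span {x})).spanFinrank ≤
        (maximalIdeal R).spanFinrank - 1 := by
      rw [hmax]
      refine (Submodule.spanFinrank_span_le_ncard_of_finite (Set.finite_range _)).trans ?_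
      rw [← Set.image_univ]
      refine (Set.ncard_image_le Set.finite_univ).trans ?_
      simp [Set.ncard_univ]
    omega
  refine ⟨IsRegularLocalRing.of_spanFinrank_maximalIdeal_le _ ?_, hrank⟩
  have h1 := ringKrullDim_le_ringKrullDim_quotient_add_encard ({x} : Set R)
    (by rw [IsLocalRing.ringJacobson_eq_maximalIdeal]; simpa using hx)
  rw [← IsRegularLocalRing.spanFinrank_maximalIdeal, Set.encard_singleton] at h1
  obtain ⟨D, hD⟩ : ∃ D : ℕ∞, ringKrullDim (R ⧸ Ideal.span {x}) = D :=
    ⟨_, (WithBot.coe_unbot _ ringKrullDim_ne_bot).symm⟩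
  rw [hD] at h1 ⊢
  norm_cast at h1 ⊢
  have h2 : ((maximalIdeal (R ⧸ Ideal.span {x})).spanFinrank : ℕ∞) + 1 ≤ D + 1 :=
    le_trans (by exact_mod_cast hrank) h1
  exact (ENat.add_le_add_iff_right ENat.one_ne_top).1 h2

/-- Induction on the embedding dimension. Prime avoidance gives `x` in the maximal ideal, outside
its square and outside all minimal primes. The quotient by `x` is regular, hence a domain, so `x`
generates a prime ideal; a minimal prime below it must vanish. -/
lemma IsRegularLocalRing.isDomain_of_spanFinrank_le (N : ℕ) : ∀ (R : Type u) [CommRing R]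
    [IsRegularLocalRing R], (maximalIdeal R).spanFinrank ≤ N → IsDomain R := by
  induction N with
  | zero =>
    intro R _ _ h
    have h1 := (Submodule.spanFinrank_eq_zero_iff_eq_bot (IsNoetherian.noetherian _)).1
      (Nat.le_zero.1 h)
    exact (IsLocalRing.isField_iff_maximalIdeal_eq.2 h1).isDomain
  | succ N ih =>
    intro R _ _ h
    by_cases h0 : maximalIdeal R = ⊥
    · exact (IsLocalRing.isField_iff_maximalIdeal_eq.2 h0).isDomain
    have hsq : ¬ maximalIdeal R ≤ maximalIdeal R ^ 2 := fun hle =>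
      h0 (Submodule.eq_bot_of_le_smul_of_le_jacobson_bot (maximalIdeal R) _
        (IsNoetherian.noetherian _) (by rwa [smul_eq_mul, ← pow_two]) (maximalIdeal_le_jacobson _))
    have hfin : (minimalPrimes R).Finite := minimalPrimes.finite_of_isNoetherianRing R
    -- Otherwise the dimension is zero, and regularity makes the maximal ideal generated by no
    -- elements.
    have hmin : ∀ p ∈ minimalPrimes R, ¬ maximalIdeal R ≤ p := by
      intro p hp hle
      have hp' : p.IsPrime := hp.1.1
      have hpm : p = maximalIdeal R := le_antisymm (le_maximalIdeal hp'.ne_top) hle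
      have h1 : (maximalIdeal R).height = 0 := by
        rw [← hpm, Ideal.height_eq_zero_iff]
        exact hp
      have h2 := IsLocalRing.maximalIdeal_height_eq_ringKrullDim (R := R)
      rw [← IsRegularLocalRing.spanFinrank_maximalIdeal, h1] at h2
      apply h0
      rw [← Submodule.spanFinrank_eq_zero_iff_eq_bot (IsNoetherian.noetherian _)]
      exact_mod_cast h2.symm
    obtain ⟨x, hx, hxn⟩ : ∃ x ∈ maximalIdeal R,
        x ∉ ⋃ i ∈ ((insert (maximalIdeal R ^ 2) hfin.toFinset : Finset (Ideal R)) : Set (Ideal R)),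
          (i : Set R) := by
      by_contra! hcon
      -- Prime avoidance tolerates two ideals that need not be prime; both places are given to the
      -- square of the maximal ideal.
      obtain ⟨i, hi, hle⟩ := (Ideal.subset_union_prime (f := id) (maximalIdeal R ^ 2)
        (maximalIdeal R ^ 2) (fun i hi hia _ => by
          rcases Finset.mem_insert.1 hi with rfl | hi
          · exact absurd rfl hia
          · exact (hfin.mem_toFinset.1 hi).1.1)).1 hcon
      rcases Finset.mem_insert.1 hi with rfl | hi
      · exact hsq hle
      · exact hmin _ (hfin.mem_toFinset.1 hi) hle
    simp only [Finset.coe_insert, Set.Finite.coe_toFinset, Set.mem_insert_iff, Set.iUnion_iUnion_eq_or_left,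
      Set.mem_union, SetLike.mem_coe, Set.mem_iUnion, not_or, not_exists] at hxn
    obtain ⟨hreg, hrank⟩ := IsRegularLocalRing.quotient_span_singleton hx hxn.1
    have hdom := ih (R ⧸ Ideal.span {x}) (by omega)
    have hprime : (Ideal.span {x}).IsPrime := (Ideal.Quotient.isDomain_iff_prime _).1 hdom
    obtain ⟨p, hp, hple⟩ := Ideal.exists_minimalPrimes_le (I := ⊥) (J := Ideal.span {x}) bot_le
    have hpp : p.IsPrime := hp.1.1
    have hxp : x ∉ p := hxn.2 p hp
    -- An element of `p` is `w * x` with `x ∉ p`, so `w ∈ p`. Thus `p` lies in its product with the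
    -- maximal ideal, and Nakayama applies.
    have hbot : p = ⊥ := by
      refine Submodule.eq_bot_of_le_smul_of_le_jacobson_bot (maximalIdeal R) _
        (IsNoetherian.noetherian _) ?_ (maximalIdeal_le_jacobson _)
      intro z hz
      obtain ⟨w, rfl⟩ := Ideal.mem_span_singleton'.1 (hple hz)
      rw [mul_comm, smul_eq_mul]
      exact Ideal.mul_mem_mul hx ((hpp.mem_or_mem hz).resolve_right hxp)
    rw [hbot] at hpp
    exact IsDomain.of_bot_isPrime R

/-- This serves to make `π` a nonzerodivisor on `R`, hence on every flat `R`-algebra. -/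
theorem IsRegularLocalRing.isDomain (R : Type u) [CommRing R] [IsRegularLocalRing R] :
    IsDomain R :=
  IsRegularLocalRing.isDomain_of_spanFinrank_le _ R le_rfl

end RegularLocalRing

/-! ### Block matrices in the general linear group -/

namespace BlockGL

open Matrix

variable {m n ι S T : Type*} [Fintype m] [DecidableEq m] [Fintype n] [DecidableEq n]
  [Fintype ι] [DecidableEq ι] [CommRing S] [CommRing T]

/-- The block matrix with rows `(1, W)` and `(0, 1)`. -/
def shear (W : Matrix m n S) : GL (m ⊕ n) S where
  val := fromBlocks 1 W 0 1
  inv := fromBlocks 1 (-W) 0 1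
  val_inv := by simp [fromBlocks_multiply, fromBlocks_one]
  inv_val := by simp [fromBlocks_multiply, fromBlocks_one]

/-- The block matrix with rows `(1, 0)` and `(W, 1)`. -/
def lowerShear (W : Matrix n m S) : GL (m ⊕ n) S where
  val := fromBlocks 1 0 W 1
  inv := fromBlocks 1 0 (-W) 1
  val_inv := by simp [fromBlocks_multiply, fromBlocks_one]
  inv_val := by simp [fromBlocks_multiply, fromBlocks_one]

/-- The block diagonal matrix with blocks `A` and `B`. -/
def diag (A : GL m S) (B : GL n S) : GL (m ⊕ n) S where
  val := fromBlocks A.1 0 0 B.1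
  inv := fromBlocks A⁻¹.1 0 0 B⁻¹.1
  val_inv := by
    simp only [fromBlocks_multiply, Matrix.mul_zero, Matrix.zero_mul, add_zero, zero_add]
    rw [show A.1 * (A⁻¹).1 = 1 from A.mul_inv, show B.1 * (B⁻¹).1 = 1 from B.mul_inv,
      fromBlocks_one]
  inv_val := by
    simp only [fromBlocks_multiply, Matrix.mul_zero, Matrix.zero_mul, add_zero, zero_add]
    rw [show (A⁻¹).1 * A.1 = 1 from A.inv_mul, show (B⁻¹).1 * B.1 = 1 from B.inv_mul,
      fromBlocks_one]

/-- The diagonal matrix with the given units on the diagonal. -/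
def ofUnits (d : ι → Sˣ) : GL ι S where
  val := diagonal fun i => (d i : S)
  inv := diagonal fun i => ((d i)⁻¹ : Sˣ)
  val_inv := by simp
  inv_val := by simp

/-- Renumbering the rows and columns of an invertible matrix independently. -/
def submatrix {κ : Type*} [Fintype κ] [DecidableEq κ] (A : GL ι S) (a b : κ ≃ ι) : GL κ S where
  val := A.1.submatrix a b
  inv := (A⁻¹).1.submatrix b a
  val_inv := by
    rw [submatrix_mul_equiv, show A.1 * (A⁻¹).1 = 1 from A.mul_inv, submatrix_one_equiv]
  inv_val := by
    rw [submatrix_mul_equiv, show (A⁻¹).1 * A.1 = 1 from A.inv_mul, submatrix_one_equiv]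

lemma shear_val (W : Matrix m n S) : (shear W).1 = fromBlocks 1 W 0 1 := rfl

lemma lowerShear_val (W : Matrix n m S) : (lowerShear W).1 = fromBlocks 1 0 W 1 := rfl

lemma diag_val (A : GL m S) (B : GL n S) : (diag A B).1 = fromBlocks A.1 0 0 B.1 := rfl

lemma ofUnits_val (d : ι → Sˣ) : (ofUnits d).1 = diagonal fun i => (d i : S) := rfl

lemma ofUnits_inv (d : ι → Sˣ) : (ofUnits d)⁻¹ = ofUnits d⁻¹ := Units.ext rfl

lemma ofUnits_map (f : S →+* T) (d : ι → Sˣ) :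
    GeneralLinearGroup.map f (ofUnits d) = ofUnits fun i => Units.map f.toMonoidHom (d i) := by
  apply Units.ext
  show (diagonal fun i => (d i : S)).map f = _
  rw [diagonal_map (map_zero f)]
  rfl

lemma shear_mul (W W' : Matrix m n S) : shear W * shear W' = shear (W + W') :=
  Units.ext (by
    rw [Units.val_mul, shear_val, shear_val, shear_val]
    simp [fromBlocks_multiply, add_comm])

lemma diag_mul (A A' : GL m S) (B B' : GL n S) :
    diag A B * diag A' B' = diag (A * A') (B * B') :=
  Units.ext (by
    rw [Units.val_mul, diag_val, diag_val, diag_val]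
    simp [fromBlocks_multiply])

lemma diag_one : diag (1 : GL m S) (1 : GL n S) = 1 := Units.ext fromBlocks_one

lemma diag_inv (A : GL m S) (B : GL n S) : (diag A B)⁻¹ = diag A⁻¹ B⁻¹ :=
  inv_eq_of_mul_eq_one_right (by rw [diag_mul, mul_inv_cancel, mul_inv_cancel, diag_one])

lemma diag_mul_shear (A : GL m S) (B : GL n S) (W : Matrix m n S) :
    diag A B * shear W = shear (A.1 * W * (B⁻¹).1) * diag A B :=
  Units.ext (by
    rw [Units.val_mul, Units.val_mul, diag_val, shear_val, shear_val]
    simp only [fromBlocks_multiply, Matrix.mul_zero, Matrix.zero_mul, add_zero, zero_add,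
      Matrix.mul_one, Matrix.one_mul]
    rw [Matrix.mul_assoc, show (B⁻¹).1 * B.1 = 1 from B.inv_mul, Matrix.mul_one])

lemma map_shear (f : S →+* T) (W : Matrix m n S) :
    GeneralLinearGroup.map f (shear W) = shear (W.map f) :=
  Units.ext (by
    show (fromBlocks 1 W 0 1).map f = fromBlocks 1 (W.map f) 0 1
    simp [fromBlocks_map])

lemma map_lowerShear (f : S →+* T) (W : Matrix n m S) :
    GeneralLinearGroup.map f (lowerShear W) = lowerShear (W.map f) :=
  Units.ext (by
    show (fromBlocks 1 0 W 1).map f = fromBlocks 1 0 (W.map f) 1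
    simp [fromBlocks_map])

lemma map_diag (f : S →+* T) (A : GL m S) (B : GL n S) :
    GeneralLinearGroup.map f (diag A B) =
      diag (GeneralLinearGroup.map f A) (GeneralLinearGroup.map f B) :=
  Units.ext (by
    show (fromBlocks A.1 0 0 B.1).map f = fromBlocks (A.1.map f) 0 0 (B.1.map f)
    simp [fromBlocks_map])

/-- A block upper triangular invertible matrix is the product of a unipotent and a block diagonal
one. -/
lemma exists_eq_shear_mul_diag {g : GL (m ⊕ n) S} {A : Matrix m m S} {B : Matrix m n S}
    {D : Matrix n n S} (hg : g.1 = fromBlocks A B 0 D) :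
    ∃ (W : Matrix m n S) (A' : GL m S) (D' : GL n S),
      A'.1 = A ∧ D'.1 = D ∧ W = B * (D'⁻¹).1 ∧ g = shear W * diag A' D' := by
  have hdet : IsUnit (A.det * D.det) := by
    rw [← det_fromBlocks_zero₂₁, ← hg]
    exact (isUnit_iff_isUnit_det _).1 g.isUnit
  have hA : IsUnit A := (isUnit_iff_isUnit_det _).2 (isUnit_of_mul_isUnit_left hdet)
  have hD : IsUnit D := (isUnit_iff_isUnit_det _).2 (isUnit_of_mul_isUnit_right hdet)
  refine ⟨B * (hD.unit⁻¹ : GL n S).1, hA.unit, hD.unit, rfl, rfl, rfl, Units.ext ?_⟩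
  rw [hg, Units.val_mul, shear_val, diag_val]
  simp only [fromBlocks_multiply, Matrix.mul_zero, Matrix.zero_mul, add_zero, zero_add,
    Matrix.one_mul]
  rw [Matrix.mul_assoc, show (hD.unit⁻¹ : GL n S).1 * hD.unit.1 = 1 from hD.unit.inv_mul,
    Matrix.mul_one]
  rfl

end BlockGL

/-! ### Diagonalization over valuation rings -/

section Smith

open Matrix

variable {O F : Type*} [CommRing O] [IsDomain O] [Field F] [Algebra O F] [IsFractionRing O F]

/-- A rectangular matrix over the fraction field of a valuation ring is equivalent, under invertible
matrices over the ring, to a diagonal one. -/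
theorem Matrix.exists_mul_mul_eq_diagonal [ValuationRing O] (n k : ℕ)
    (W : Matrix (Fin n) (Fin k) F) :
    ∃ (U : GL (Fin n) O) (V : GL (Fin k) O) (c : ℕ → F),
      (GeneralLinearGroup.map (algebraMap O F) U).1 * W *
        (GeneralLinearGroup.map (algebraMap O F) V).1 =
      Matrix.of fun (i : Fin n) (j : Fin k) => if i.val = j.val then c i else 0 := by
  induction n generalizing k with
  | zero => exact ⟨1, 1, 0, by ext i; exact i.elim0⟩
  | succ n ih =>
  obtain _ | k := k
  · exact ⟨1, 1, 0, by ext i j; exact j.elim0⟩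
  -- The pivot is an entry of largest valuation, so all other entries are integral multiples of it.
  obtain ⟨⟨i₀, j₀⟩, -, hmax⟩ := Finset.exists_max_image Finset.univ
    (fun p : Fin (n + 1) × Fin (k + 1) => ValuationRing.valuation O F (W p.1 p.2)) ⟨(0, 0), by simp⟩
  by_cases h0 : W i₀ j₀ = 0
  · refine ⟨1, 1, 0, ?_⟩
    have : W = 0 := by
      ext i j
      have := hmax (i, j) (by simp)
      simpa [h0] using this
    subst this
    ext i j
    simp
  have hq : ∀ i j, ∃ q : O, W i j = algebraMap O F q * W i₀ j₀ := by
    intro i j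
    have h1 : ValuationRing.valuation O F (W i j / W i₀ j₀) ≤ 1 := by
      rw [map_div₀]
      exact div_le_one_of_le₀ (hmax (i, j) (by simp)) zero_le
    obtain ⟨q, hq⟩ := (ValuationRing.mem_integer_iff O F _).1 h1
    exact ⟨q, by rw [hq]; field_simp⟩
  let e : ∀ l : ℕ, Fin (l + 1) ≃ Unit ⊕ Fin l := fun l =>
    ((finSuccEquiv l).trans (Equiv.optionEquivSumPUnit _)).trans (Equiv.sumComm _ _)
  have he0 : ∀ l, (e l).symm (Sum.inl ()) = 0 := fun l => by simp [e]
  have hes : ∀ l i, (e l).symm (Sum.inr i) = i.succ := fun l i => by simp [e]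
  let en : Fin (n + 1) ≃ Unit ⊕ Fin n := (Equiv.swap 0 i₀).trans (e n)
  let ek : Fin (k + 1) ≃ Unit ⊕ Fin k := (Equiv.swap 0 j₀).trans (e k)
  have hen : en.symm (Sum.inl ()) = i₀ := by
    show (Equiv.swap 0 i₀).symm ((e n).symm (Sum.inl ())) = i₀
    rw [he0, Equiv.symm_swap, Equiv.swap_apply_left]
  have hek : ek.symm (Sum.inl ()) = j₀ := by
    show (Equiv.swap 0 j₀).symm ((e k).symm (Sum.inl ())) = j₀
    rw [he0, Equiv.symm_swap, Equiv.swap_apply_left]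
  choose q hq using hq
  let Qc : Matrix (Fin n) Unit O := Matrix.of fun i _ => q (en.symm (Sum.inr i)) j₀
  let Qr : Matrix Unit (Fin k) O := Matrix.of fun _ j => q i₀ (ek.symm (Sum.inr j))
  let w : Matrix Unit Unit F := Matrix.of fun _ _ => W i₀ j₀
  let M : Matrix (Fin n) (Fin k) F :=
    Matrix.of fun i j => W (en.symm (Sum.inr i)) (ek.symm (Sum.inr j))
  have hW : W.submatrix en.symm ek.symm =
      fromBlocks w (w * Qr.map (algebraMap O F)) (Qc.map (algebraMap O F) * w) M := by
    ext (i | i) (j | j)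
    · show W (en.symm (Sum.inl ())) (ek.symm (Sum.inl ())) = W i₀ j₀
      rw [hen, hek]
    · simp only [submatrix_apply, fromBlocks_apply₁₂, mul_apply, Finset.univ_unique,
        Finset.sum_singleton]
      show W (en.symm (Sum.inl ())) _ = W i₀ j₀ * algebraMap O F (q i₀ _)
      rw [hen, hq, mul_comm]
    · simp only [submatrix_apply, fromBlocks_apply₂₁, mul_apply, Finset.univ_unique,
        Finset.sum_singleton]
      show W _ (ek.symm (Sum.inl ())) = algebraMap O F (q _ j₀) * W i₀ j₀
      rw [hek, hq]
    · rfl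
  -- The induction continues with the Schur complement of the pivot.
  obtain ⟨U, V, c, h⟩ := ih k (M - Qc.map (algebraMap O F) * w * Qr.map (algebraMap O F))
  let U' : GL (Unit ⊕ Fin n) O := BlockGL.diag 1 U * BlockGL.lowerShear (-Qc)
  let V' : GL (Unit ⊕ Fin k) O := BlockGL.shear (-Qr) * BlockGL.diag 1 V
  have hUV : (GeneralLinearGroup.map (algebraMap O F) U').1 * W.submatrix en.symm ek.symm *
      (GeneralLinearGroup.map (algebraMap O F) V').1 =
      fromBlocks w 0 0 (Matrix.of fun (i : Fin n) (j : Fin k) =>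
        if i.val = j.val then c i else 0) := by
    rw [← h, hW]
    simp only [U', V', map_mul, BlockGL.map_diag, BlockGL.map_shear, BlockGL.map_lowerShear,
      Units.val_mul, BlockGL.diag_val, BlockGL.shear_val, BlockGL.lowerShear_val, map_one,
      Units.val_one, fromBlocks_multiply, Matrix.mul_zero, Matrix.zero_mul, add_zero, zero_add,
      Matrix.mul_one, Matrix.one_mul]
    have hneg : ∀ {a b : Type} (A : Matrix a b O),
        (-A).map (algebraMap O F) = -A.map (algebraMap O F) := fun A => by ext; simp
    simp only [hneg]
    congr 1
    · simp only [Matrix.mul_neg, Matrix.neg_mul, ← Matrix.mul_assoc, neg_add_cancel]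
    · simp only [Matrix.mul_neg, Matrix.neg_mul, ← Matrix.mul_assoc, neg_add_cancel]
    · simp [Matrix.mul_add, Matrix.add_mul, Matrix.mul_assoc, sub_eq_add_neg, add_comm]
  -- The two sides are renumbered differently: the transposition bringing the pivot to the corner is
  -- thereby absorbed into `U` and `V`.
  refine ⟨BlockGL.submatrix U' (e n) en, BlockGL.submatrix V' ek (e k),
    fun l => Nat.casesOn l (W i₀ j₀) c, ?_⟩
  have hfin : (GeneralLinearGroup.map (algebraMap O F) (BlockGL.submatrix U' (e n) en)).1 * W *
      (GeneralLinearGroup.map (algebraMap O F) (BlockGL.submatrix V' ek (e k))).1 =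
      ((GeneralLinearGroup.map (algebraMap O F) U').1 * W.submatrix en.symm ek.symm *
        (GeneralLinearGroup.map (algebraMap O F) V').1).submatrix (e n) (e k) := by
    rw [← submatrix_mul_equiv _ _ (e n) ek (e k), ← submatrix_mul_equiv _ _ (e n) en ek]
    congr 2
    ext i j
    simp
  rw [hfin, hUV]
  ext i j
  refine Fin.cases ?_ (fun i => ?_) i <;> refine Fin.cases ?_ (fun j => ?_) j
  · rw [submatrix_apply, ← he0, ← he0 k, Equiv.apply_symm_apply, Equiv.apply_symm_apply, he0, he0]
    simp [w]
  · rw [submatrix_apply, ← he0, ← hes, Equiv.apply_symm_apply, Equiv.apply_symm_apply, he0, hes]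
    simp
  · rw [submatrix_apply, ← he0, ← hes, Equiv.apply_symm_apply, Equiv.apply_symm_apply, he0, hes]
    simp
  · rw [submatrix_apply, ← hes, ← hes k, Equiv.apply_symm_apply, Equiv.apply_symm_apply, hes, hes]
    simp

end Smith

/-! ### Representatives of the double cosets -/

namespace BlockGL

open Matrix

/-- The `n × k` matrix with entries `1` at the positions `(i, i)` and `0` elsewhere. -/
def pairing (S : Type*) [CommRing S] (n k : ℕ) : Matrix (Fin n) (Fin k) S :=
  Matrix.of fun i j => if i.val = j.val then 1 else 0

lemma pairing_apply (S : Type*) [CommRing S] {n k : ℕ} (i : Fin n) (j : Fin k) :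
    pairing S n k i j = if i.val = j.val then 1 else 0 := rfl

lemma pairing_map {S T : Type*} [CommRing S] [CommRing T] (f : S →+* T) (n k : ℕ) :
    (pairing S n k).map f = pairing T n k := by
  ext i j
  rw [map_apply, pairing_apply, pairing_apply, apply_ite f, map_one, map_zero]

section DVR

variable {O F : Type*} [CommRing O] [IsDomain O] [IsDiscreteValuationRing O] [Field F]
  [Algebra O F] [IsFractionRing O F] {ϖ : O}

/-- A nonintegral `x` is a unit times a negative power of `ϖ`. An integral `x`, including zero, is
written as `1 + (x - 1)`: no zero entries have to be kept, and so a single element of `𝔛` will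
suffice. -/
lemma exists_mul_unit_eq_inv_pow_add (hϖ : Irreducible ϖ) (x : F) :
    ∃ (ε : Oˣ) (a : ℕ) (b : O), x * algebraMap O F ε = (algebraMap O F ϖ)⁻¹ ^ a + algebraMap O F b := by
  rcases ValuationRing.isInteger_or_isInteger O x with ⟨y, hy⟩ | ⟨y, hy⟩
  · exact ⟨1, 0, y - 1, by simp [hy]⟩
  · by_cases hy0 : y = 0
    · refine ⟨1, 0, -1, ?_⟩
      have : x = 0 := by simpa [hy0] using hy.symm
      simp [this]
    · obtain ⟨a, ε, rfl⟩ := IsDiscreteValuationRing.eq_unit_mul_pow_irreducible hy0 hϖ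
      refine ⟨ε, a, 0, ?_⟩
      have hx : x = (algebraMap O F (ε * ϖ ^ a))⁻¹ := by rw [hy, inv_inv]
      have hε : algebraMap O F ε ≠ 0 := by simp
      rw [hx, map_mul, map_pow, map_zero, add_zero, mul_inv, inv_pow]
      field_simp

lemma exists_mul_mul_eq_pairing_add (hϖ : Irreducible ϖ) {n k : ℕ}
    (W : Matrix (Fin n) (Fin k) F) :
    ∃ (U : GL (Fin n) O) (V : GL (Fin k) O) (a : Fin k → ℕ) (N : Matrix (Fin n) (Fin k) O),
      (∀ j, n ≤ j.val → a j = 0) ∧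
      (GeneralLinearGroup.map (algebraMap O F) U).1 * W *
        (GeneralLinearGroup.map (algebraMap O F) V).1 =
      pairing F n k * diagonal (fun j => (algebraMap O F ϖ)⁻¹ ^ a j) + N.map (algebraMap O F) := by
  obtain ⟨U, V, c, h⟩ := Matrix.exists_mul_mul_eq_diagonal (O := O) n k W
  choose ε a b hc using fun l => exists_mul_unit_eq_inv_pow_add hϖ (c l)
  -- A column with index at least `n` does not meet the diagonal, so its exponent is free. It is set
  -- to `0`, which the congruence argument requires.
  refine ⟨U, V * ofUnits fun j : Fin k => ε j, fun j => if n ≤ j.val then 0 else a j,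
    Matrix.of fun i j => if i.val = j.val then b i else 0, fun j hj => if_pos hj, ?_⟩
  rw [map_mul, ofUnits_map, Units.val_mul, ofUnits_val, ← Matrix.mul_assoc, h]
  ext i j
  rw [mul_diagonal, Matrix.add_apply, mul_diagonal, pairing_apply, map_apply, of_apply, of_apply]
  by_cases hij : i.val = j.val
  · have hj : ¬ n ≤ j.val := by omega
    simp only [if_pos hij, if_neg hj, one_mul]
    rw [← hij]
    exact hc i
  · simp [hij]

/-- Every invertible matrix over the fraction field of a discrete valuation ring is the product of an
integral one, of one of the standard representatives, and of a block diagonal one. -/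
theorem exists_eq_integral_mul_representative_mul_diag (hϖ : Irreducible ϖ)
    (u : Fˣ) (hu : (u : F) = algebraMap O F ϖ) {n k : ℕ}
    (g : GL (Fin n ⊕ Fin k) F) :
    ∃ (a : Fin k → ℕ) (c : GL (Fin n ⊕ Fin k) O) (A : GL (Fin n) F) (B : GL (Fin k) F),
      (∀ j, n ≤ j.val → a j = 0) ∧
      g = GeneralLinearGroup.map (algebraMap O F) c *
        (diag 1 (ofUnits fun j => u ^ a j) * shear (pairing F n k)) * diag A B := by
  -- Only the first `n` columns are diagonalized. The lower `k` rows of the result vanish, so the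
  -- whole matrix becomes block upper triangular.
  obtain ⟨U, V, c, h⟩ := Matrix.exists_mul_mul_eq_diagonal (O := O) (n + k) n
    ((g.1.submatrix finSumFinEquiv.symm Sum.inl))
  set U' : GL (Fin n ⊕ Fin k) O := submatrix U finSumFinEquiv finSumFinEquiv
  have hblock : ∃ (A : Matrix (Fin n) (Fin n) F) (B : Matrix (Fin n) (Fin k) F)
      (D : Matrix (Fin k) (Fin k) F),
      (GeneralLinearGroup.map (algebraMap O F) U' * g *
        diag (GeneralLinearGroup.map (algebraMap O F) V) 1).1 = fromBlocks A B 0 D := by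
    set X := (GeneralLinearGroup.map (algebraMap O F) U' * g *
        diag (GeneralLinearGroup.map (algebraMap O F) V) 1).1
    refine ⟨X.toBlocks₁₁, X.toBlocks₁₂, X.toBlocks₂₂, ?_⟩
    have h21 : X.toBlocks₂₁ = 0 := by
      ext i j
      have h1 := congrFun (congrFun h (finSumFinEquiv (Sum.inr i))) j
      have h2 : (finSumFinEquiv (m := n) (n := k) (Sum.inr i)).val ≠ j.val := by
        simp; omega
      rw [of_apply, if_neg h2] at h1
      rw [Matrix.zero_apply, ← h1]
      show ((GeneralLinearGroup.map (algebraMap O F) U').1 * g.1 *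
        fromBlocks (GeneralLinearGroup.map (algebraMap O F) V).1 0 0 1 :
        Matrix (Fin n ⊕ Fin k) (Fin n ⊕ Fin k) F) (Sum.inr i) (Sum.inl j) = _
      rw [mul_apply, mul_apply, Fintype.sum_sum_type]
      simp only [fromBlocks_apply₁₁, fromBlocks_apply₂₁, Matrix.zero_apply, mul_zero,
        Finset.sum_const_zero, add_zero]
      refine Finset.sum_congr rfl fun l _ => ?_
      congr 1
      rw [mul_apply, mul_apply, ← finSumFinEquiv.sum_comp]
      refine Finset.sum_congr rfl fun l' _ => ?_
      rw [submatrix_apply, Equiv.symm_apply_apply]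
      rfl
    rw [← h21, fromBlocks_toBlocks]
  obtain ⟨A, B, D, hABD⟩ := hblock
  obtain ⟨W, A', D', -, -, -, hg⟩ := exists_eq_shear_mul_diag hABD
  obtain ⟨U₁, V₁, a, N, ha, hW⟩ := exists_mul_mul_eq_pairing_add hϖ W
  refine ⟨a, U'⁻¹ * diag U₁⁻¹ V₁ * shear N,
    (GeneralLinearGroup.map (algebraMap O F) U₁) * A' *
      (GeneralLinearGroup.map (algebraMap O F) V)⁻¹,
    (ofUnits fun j => u ^ a j)⁻¹ * (GeneralLinearGroup.map (algebraMap O F) V₁)⁻¹ * D', ha, ?_⟩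
  -- Conjugation by a block diagonal matrix performs the row and column operations on the shear
  -- parameter.
  have h1 : diag (GeneralLinearGroup.map (algebraMap O F) U₁)
      (GeneralLinearGroup.map (algebraMap O F) V₁)⁻¹ * shear W =
      shear (N.map (algebraMap O F)) *
        shear (pairing F n k * diagonal (fun j => (algebraMap O F ϖ)⁻¹ ^ a j)) *
        diag (GeneralLinearGroup.map (algebraMap O F) U₁)
          (GeneralLinearGroup.map (algebraMap O F) V₁)⁻¹ := by
    rw [diag_mul_shear, inv_inv, hW, shear_mul, add_comm]
  -- The negative powers arise from conjugating the constant shear by `diag(1, u ^ a)`.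
  have h2 : shear (pairing F n k * diagonal (fun j => (algebraMap O F ϖ)⁻¹ ^ a j)) *
      diag 1 (ofUnits fun j => u ^ a j) = diag 1 (ofUnits fun j => u ^ a j) * shear (pairing F n k) := by
    rw [diag_mul_shear, Units.val_one, Matrix.one_mul, ofUnits_inv, ofUnits_val]
    congr 4
    funext j
    simp [hu]
  set D₀ : GL (Fin k) F := ofUnits fun j => u ^ a j
  have h3 : g = (GeneralLinearGroup.map (algebraMap O F) U')⁻¹ * (shear W * diag A' D') *
      (diag (GeneralLinearGroup.map (algebraMap O F) V) 1)⁻¹ := by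
    rw [← hg]
    group
  have h4 : shear W = (diag (GeneralLinearGroup.map (algebraMap O F) U₁)
      (GeneralLinearGroup.map (algebraMap O F) V₁)⁻¹)⁻¹ * (shear (N.map (algebraMap O F)) *
        (diag 1 D₀ * shear (pairing F n k) * (diag 1 D₀)⁻¹) *
        diag (GeneralLinearGroup.map (algebraMap O F) U₁)
          (GeneralLinearGroup.map (algebraMap O F) V₁)⁻¹) := by
    rw [← h2, mul_inv_cancel_right, ← h1]
    group
  rw [h3, h4]
  simp only [map_mul, map_inv, map_diag, map_shear, diag_inv, inv_inv, inv_one, mul_assoc, diag_mul,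
    one_mul, mul_one]

end DVR

end BlockGL

/-! ### Congruence subgroups -/

namespace BlockGL

open Matrix

/-- Block elimination with the upper left block as pivot; `D` is its Schur complement. -/
lemma exists_eq_lowerShear_mul {m n S : Type*} [Fintype m] [DecidableEq m] [Fintype n]
    [DecidableEq n] [CommRing S] (g : GL (m ⊕ n) S) (h : IsUnit g.1.toBlocks₁₁) :
    ∃ (W : Matrix n m S) (g' : GL (m ⊕ n) S) (D : Matrix n n S),
      g = lowerShear W * g' ∧ g'.1 = fromBlocks g.1.toBlocks₁₁ g.1.toBlocks₁₂ 0 D ∧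
      W = g.1.toBlocks₂₁ * (h.unit⁻¹ : GL m S).1 := by
  refine ⟨_, (lowerShear (g.1.toBlocks₂₁ * (h.unit⁻¹ : GL m S).1))⁻¹ * g,
    g.1.toBlocks₂₂ - g.1.toBlocks₂₁ * (h.unit⁻¹ : GL m S).1 * g.1.toBlocks₁₂, by group, ?_, rfl⟩
  · show fromBlocks 1 0 (-(g.1.toBlocks₂₁ * (h.unit⁻¹ : GL m S).1)) 1 * g.1 = _
    conv_lhs => rhs; rw [← fromBlocks_toBlocks g.1]
    rw [fromBlocks_multiply]
    congr 1
    · simp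
    · simp
    · rw [Matrix.neg_mul, Matrix.mul_assoc, show (h.unit⁻¹ : GL m S).1 * g.1.toBlocks₁₁ = 1 from
        h.unit.inv_mul]
      simp
    · rw [Matrix.neg_mul, Matrix.one_mul, sub_eq_add_neg, add_comm]

lemma shear_zero {m n S : Type*} [Fintype m] [DecidableEq m] [Fintype n]
    [DecidableEq n] [CommRing S] : shear (0 : Matrix m n S) = 1 := Units.ext fromBlocks_one

lemma lowerShear_zero {m n S : Type*} [Fintype m] [DecidableEq m] [Fintype n]
    [DecidableEq n] [CommRing S] : lowerShear (0 : Matrix n m S) = 1 := Units.ext fromBlocks_one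

lemma isUnit_of_map_quotient_eq_one {O : Type*} [CommRing O] [IsLocalRing O] {I : Ideal O}
    (hI : I ≤ IsLocalRing.maximalIdeal O) {m : Type*} [Fintype m] [DecidableEq m]
    {A : Matrix m m O} (hA : A.map (Ideal.Quotient.mk I) = 1) : IsUnit A := by
  rw [isUnit_iff_isUnit_det]
  have h : Ideal.Quotient.mk I A.det = 1 := by
    rw [RingHom.map_det, RingHom.mapMatrix_apply, hA, det_one]
  rw [← map_one (Ideal.Quotient.mk I), Ideal.Quotient.eq] at h
  by_contra hu
  have h1 : A.det ∈ IsLocalRing.maximalIdeal O := hu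
  exact (IsLocalRing.maximalIdeal.isMaximal O).ne_top ((Ideal.eq_top_iff_one _).2
    (by simpa using (IsLocalRing.maximalIdeal O).sub_mem h1 (hI h)))

/-- The group-theoretic core of the congruence argument. Here `δ` is the diagonal matrix, `l` a
lower shear with conjugate `l'`, `p` the standard shear, `a` and `s` factors commuting with `δ`, and
`x`, `y` are block diagonal. -/
lemma mul_eq_of_commute {G : Type*} [Group G] (δ l l' a s p x y : G) (hl : δ * l = l' * δ)
    (ha : δ * a = a * δ) (hs : δ * s = s * δ) :
    δ * (l * (a * (s * p) * x * y)) = l' * a * s * (δ * p) * (x * y) := by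
  have h1 : δ * l * a * s = l' * a * s * δ := by
    rw [hl, mul_assoc l' δ a, ha, ← mul_assoc, mul_assoc (l' * a) δ s, hs, ← mul_assoc]
  calc δ * (l * (a * (s * p) * x * y)) = δ * l * a * s * p * x * y := by group
    _ = _ := by rw [h1]; group

/-- A principal congruence subgroup of `GL` moves the standard representatives, translated by a
contracting diagonal matrix, only within their orbits under the same congruence subgroup. -/
theorem exists_congruent_mul_representative_mul_diag {O F : Type*} [CommRing O] [IsLocalRing O]
    {I : Ideal O} (hI : I ≤ IsLocalRing.maximalIdeal O) [CommRing F] [Algebra O F] {n k : ℕ}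
    (d : Fin k → Fˣ) (d' : Fin k → O) (hd : ∀ j, algebraMap O F (d' j) = d j)
    (hd' : ∀ j, n ≤ j.val → d' j = 1) (c : GL (Fin n ⊕ Fin k) O)
    (hc : GeneralLinearGroup.map (Ideal.Quotient.mk I) c = 1) :
    ∃ (c' : GL (Fin n ⊕ Fin k) O) (A : GL (Fin n) F) (B : GL (Fin k) F),
      GeneralLinearGroup.map (Ideal.Quotient.mk I) c' = 1 ∧
      diag 1 (ofUnits d) * GeneralLinearGroup.map (algebraMap O F) c * shear (pairing F n k) =
        GeneralLinearGroup.map (algebraMap O F) c' *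
          (diag 1 (ofUnits d) * shear (pairing F n k)) * diag A B := by
  have hc1 : ∀ x y, Ideal.Quotient.mk I (c.1 x y) =
      (1 : Matrix (Fin n ⊕ Fin k) (Fin n ⊕ Fin k) (O ⧸ I)) x y := by
    intro x y
    have h : (GeneralLinearGroup.map (Ideal.Quotient.mk I) c).1 = 1 := by rw [hc, Units.val_one]
    exact congrFun (congrFun h x) y
  have h11I : c.1.toBlocks₁₁.map (Ideal.Quotient.mk I) = (1 : Matrix (Fin n) (Fin n) (O ⧸ I)) := by
    ext i j
    rw [show (c.1.toBlocks₁₁.map (Ideal.Quotient.mk I)) i j = _ from hc1 (Sum.inl i) (Sum.inl j)]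
    simp [one_apply]
  have h11 := isUnit_of_map_quotient_eq_one hI h11I
  obtain ⟨W₀, c₁, e, hcL, hc₁, hW₀⟩ := exists_eq_lowerShear_mul (m := Fin n) (n := Fin k) (S := O) c h11
  have hW₀I : W₀.map (Ideal.Quotient.mk I) = 0 := by
    have : c.1.toBlocks₂₁.map (Ideal.Quotient.mk I) = 0 := by
      ext i j
      rw [show (c.1.toBlocks₂₁.map (Ideal.Quotient.mk I)) i j = _ from hc1 (Sum.inr i) (Sum.inl j)]
      simp [one_apply]
    rw [hW₀, Matrix.map_mul, this, Matrix.zero_mul]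
  have hc₁I : GeneralLinearGroup.map (Ideal.Quotient.mk I) c₁ = 1 := by
    rw [hcL, map_mul, map_lowerShear, hW₀I, lowerShear_zero, one_mul] at hc
    exact hc
  -- Modulo block diagonal matrices on the right, the upper triangular part moves the standard shear
  -- to another shear, whose parameter is still the pairing modulo `I`.
  obtain ⟨W, a, e', ha, he', -, hshear⟩ := exists_eq_shear_mul_diag
    (g := c₁ * shear (pairing O n k)) (A := c.1.toBlocks₁₁)
    (B := c.1.toBlocks₁₁ * pairing O n k + c.1.toBlocks₁₂) (D := e) (by
      rw [Units.val_mul, hc₁, shear_val, fromBlocks_multiply]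
      simp)
  have hWI : W.map (Ideal.Quotient.mk I) = pairing (O ⧸ I) n k := by
    have h1 := congrArg (GeneralLinearGroup.map (Ideal.Quotient.mk I)) hshear
    rw [map_mul, hc₁I, one_mul, map_mul, map_shear, map_shear, map_diag, pairing_map] at h1
    have h2 := congrArg Units.val h1
    rw [Units.val_mul, shear_val, shear_val, diag_val, fromBlocks_multiply, fromBlocks_inj] at h2
    obtain ⟨-, h3, -, h4⟩ := h2
    rw [Matrix.zero_mul, zero_add, Matrix.one_mul] at h4
    rw [← h4, Matrix.mul_zero, zero_add, Matrix.mul_one] at h3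
    exact h3.symm
  have hWI' : ∀ i j, Ideal.Quotient.mk I (W i j) = if i.val = j.val then 1 else 0 := fun i j =>
    congrFun (congrFun hWI i) j
  -- The columns of `W` below `min n k` are absorbed into a matrix `A'` congruent to `1`, acting on
  -- the left of the pairing. The columns from `n` on cannot be obtained this way; they form `B'`,
  -- which is congruent to `0`.
  let A' : Matrix (Fin n) (Fin n) O :=
    Matrix.of fun i j => if h : j.val < k then W i ⟨j, h⟩ else (1 : Matrix _ _ O) i j
  let B' : Matrix (Fin n) (Fin k) O :=
    Matrix.of fun i j => if j.val < n then 0 else W i j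
  have hA'I : A'.map (Ideal.Quotient.mk I) = 1 := by
    ext i j
    simp only [A', map_apply, of_apply]
    split_ifs with h
    · rw [hWI']
      simp [one_apply, Fin.ext_iff]
    · simp [one_apply, apply_ite (Ideal.Quotient.mk I)]
  have hB'I : B'.map (Ideal.Quotient.mk I) = 0 := by
    ext i j
    simp only [B', map_apply, of_apply, Matrix.zero_apply]
    split_ifs with h
    · simp
    · rw [hWI', if_neg (by omega)]
  have hA'u := isUnit_of_map_quotient_eq_one hI hA'I
  have hW : W = A' * pairing O n k + B' := by
    ext i j
    rw [Matrix.add_apply, mul_apply]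
    simp only [pairing_apply, mul_ite, mul_one, mul_zero, A', B', of_apply]
    by_cases hj : j.val < n
    · rw [Finset.sum_eq_single ⟨j.val, hj⟩]
      · simp [hj]
      · intro l _ hl
        rw [if_neg (fun h => hl (Fin.ext h))]
      · simp
    · rw [Finset.sum_eq_zero, if_neg hj, zero_add]
      intro l _
      rw [if_neg (by omega)]
  let N : Matrix (Fin n) (Fin k) O := (hA'u.unit⁻¹ : GL (Fin n) O).1 * B'
  have hNI : N.map (Ideal.Quotient.mk I) = 0 := by
    rw [Matrix.map_mul, hB'I, Matrix.mul_zero]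
  have hN0 : ∀ i j, j.val < n → N i j = 0 := by
    intro i j hj
    simp only [N, mul_apply, B', of_apply, if_pos hj, mul_zero, Finset.sum_const_zero]
  have hWN : shear W = diag hA'u.unit 1 * (shear N * shear (pairing O n k)) *
      (diag hA'u.unit 1)⁻¹ := by
    rw [shear_mul, diag_mul_shear, mul_inv_cancel_right, inv_one, Units.val_one, Matrix.mul_one,
      Matrix.mul_add, hW, ← Matrix.mul_assoc, show hA'u.unit.1 * (hA'u.unit⁻¹ : GL (Fin n) O).1 = 1
        from hA'u.unit.mul_inv, Matrix.one_mul, add_comm]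
    rfl
  -- `N` is supported on the columns `j ≥ n`, where `d j = 1`.
  have hD1 : diag 1 (ofUnits d) * shear (N.map (algebraMap O F)) =
      shear (N.map (algebraMap O F)) * diag (1 : GL (Fin n) F) (ofUnits d) := by
    rw [diag_mul_shear, Units.val_one, Matrix.one_mul, ofUnits_inv, ofUnits_val]
    congr 2
    ext i j
    rw [mul_diagonal]
    by_cases hj : j.val < n
    · simp [hN0 i j hj]
    · have : d j = 1 := Units.ext (by rw [← hd, hd' j (by omega), map_one, Units.val_one])
      simp [this]
  -- Contraction: conjugating the lower shear multiplies its parameter by the integral matrix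
  -- `diagonal d'`, so it stays congruent to `0`.
  have hD2 : diag (1 : GL (Fin n) F) (ofUnits d) * lowerShear (W₀.map (algebraMap O F)) =
      lowerShear ((diagonal d' * W₀).map (algebraMap O F)) * diag 1 (ofUnits d) := by
    apply Units.ext
    rw [Units.val_mul, Units.val_mul, diag_val, lowerShear_val, lowerShear_val, fromBlocks_multiply,
      fromBlocks_multiply, Matrix.map_mul, diagonal_map (map_zero _), ofUnits_val]
    simp [hd]
  refine ⟨lowerShear (diagonal d' * W₀) * diag hA'u.unit 1 * shear N,
    (GeneralLinearGroup.map (algebraMap O F) (hA'u.unit⁻¹ * a)),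
    GeneralLinearGroup.map (algebraMap O F) e', ?_, ?_⟩
  · rw [map_mul, map_mul, map_lowerShear, Matrix.map_mul, hW₀I, Matrix.mul_zero, lowerShear_zero,
      map_shear, hNI, shear_zero, map_diag, map_one, one_mul, mul_one,
      show GeneralLinearGroup.map (Ideal.Quotient.mk I) hA'u.unit = 1 from Units.ext hA'I, diag_one]
  · have h1 : c * shear (pairing O n k) = lowerShear W₀ * (diag hA'u.unit 1 *
        (shear N * shear (pairing O n k)) * (diag hA'u.unit 1)⁻¹ * diag a e') := by
      rw [hcL, mul_assoc, hshear, hWN]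
    have h2 := congrArg (GeneralLinearGroup.map (algebraMap O F)) h1
    rw [map_mul, map_shear, pairing_map] at h2
    have h3 : diag (1 : GL (Fin n) F) (ofUnits d) *
        diag (GeneralLinearGroup.map (algebraMap O F) hA'u.unit) 1 =
        diag (GeneralLinearGroup.map (algebraMap O F) hA'u.unit) 1 * diag 1 (ofUnits d) := by
      rw [diag_mul, diag_mul, one_mul, one_mul, mul_one, mul_one]
    have h4 : diag (GeneralLinearGroup.map (algebraMap O F) (hA'u.unit⁻¹ * a))
        (GeneralLinearGroup.map (algebraMap O F) e') =
        (diag (GeneralLinearGroup.map (algebraMap O F) hA'u.unit) 1)⁻¹ *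
          diag (GeneralLinearGroup.map (algebraMap O F) a)
            (GeneralLinearGroup.map (algebraMap O F) e') := by
      rw [diag_inv, diag_mul, inv_one, one_mul, map_mul, map_inv]
    rw [mul_assoc, h2, h4]
    simp only [map_mul, map_lowerShear, map_diag, map_shear, map_inv, pairing_map, map_one]
    exact mul_eq_of_commute _ _ _ _ _ _ _ _ hD2 h3 hD1

end BlockGL

/-! ### The quotient as a variety of projections -/

/-- A finite product of localizations is flat, and each prime misses some `f i`, so it lies in the
image of that factor. -/
lemma Module.FaithfullyFlat.pi_localization {S : Type u} [CommRing S] {I : Type} [Finite I]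
    (f : I → S) (hf : Ideal.span (Set.range f) = ⊤) :
    Module.FaithfullyFlat S (∀ i, Localization.Away (f i)) := by
  have : Fintype I := Fintype.ofFinite I
  classical
  have : Module.Flat S (∀ i, Localization.Away (f i)) :=
    Module.Flat.of_linearEquiv (DFinsupp.linearEquivFunOnFintype (R := S)
      (M := fun i => Localization.Away (f i))).symm
  refine Module.FaithfullyFlat.of_comap_surjective fun P => ?_
  obtain ⟨i, hi⟩ : ∃ i, f i ∉ P.asIdeal := by
    by_contra! h
    refine P.2.ne_top (top_le_iff.1 (hf ▸ Ideal.span_le.2 ?_))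
    rintro _ ⟨i, rfl⟩
    exact h i
  have h1 : P ∈ Set.range (PrimeSpectrum.comap (algebraMap S (Localization.Away (f i)))) := by
    rw [PrimeSpectrum.localization_away_comap_range (Localization.Away (f i)) (f i)]
    exact hi
  obtain ⟨Q, rfl⟩ := h1
  refine ⟨PrimeSpectrum.comap (Pi.evalRingHom (fun i => Localization.Away (f i)) i) Q, ?_⟩
  rw [← PrimeSpectrum.comap_comp_apply]
  rfl

namespace BlockGL

open Matrix

section Projection

variable {m n S T : Type*} [Fintype m] [DecidableEq m] [Fintype n] [DecidableEq n]
  [CommRing S] [CommRing T]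

/-- The conjugate by `g` of the projection to the first block. -/
def proj (g : GL (m ⊕ n) S) : Matrix (m ⊕ n) (m ⊕ n) S :=
  g.1 * fromBlocks 1 0 0 0 * (g⁻¹).1

lemma map_proj (f : S →+* T) (g : GL (m ⊕ n) S) :
    (proj g).map f = proj (GeneralLinearGroup.map f g) := by
  have h : (fromBlocks 1 0 0 0 : Matrix (m ⊕ n) (m ⊕ n) S).map f = fromBlocks 1 0 0 0 := by
    simp [fromBlocks_map]
  rw [proj, Matrix.map_mul, Matrix.map_mul, h, proj, ← map_inv]
  rfl

lemma proj_mul_self (g : GL (m ⊕ n) S) : proj g * proj g = proj g := by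
  have h : (fromBlocks 1 0 0 0 : Matrix (m ⊕ n) (m ⊕ n) S) * fromBlocks 1 0 0 0 =
      fromBlocks 1 0 0 0 := by simp [fromBlocks_multiply]
  calc proj g * proj g = g.1 * fromBlocks 1 0 0 0 * ((g⁻¹).1 * g.1) * fromBlocks 1 0 0 0 *
        (g⁻¹).1 := by simp only [proj, Matrix.mul_assoc]
    _ = _ := by rw [show (g⁻¹).1 * g.1 = 1 from g.inv_mul, Matrix.mul_one, Matrix.mul_assoc g.1, h,
      proj]

lemma one_sub_proj (g : GL (m ⊕ n) S) :
    1 - proj g = g.1 * fromBlocks 0 0 0 1 * (g⁻¹).1 := by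
  have h : (fromBlocks 0 0 0 1 : Matrix (m ⊕ n) (m ⊕ n) S) = 1 - fromBlocks 1 0 0 0 := by
    rw [← fromBlocks_one, sub_eq_add_neg, fromBlocks_neg, fromBlocks_add]
    simp
  rw [h, Matrix.mul_sub, Matrix.sub_mul, Matrix.mul_one, show g.1 * (g⁻¹).1 = 1 from g.mul_inv, proj]

/-- Equality of the projections means that `g⁻¹ * g'` commutes with the standard projection, that
is, is block diagonal. -/
lemma proj_eq_iff (g g' : GL (m ⊕ n) S) :
    proj g = proj g' ↔ ∃ (A : GL m S) (D : GL n S), diag A D = g⁻¹ * g' := by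
  constructor
  · intro h
    have h1 : fromBlocks 1 0 0 0 * (g⁻¹ * g').1 = (g⁻¹ * g').1 * fromBlocks 1 0 0 0 := by
      have h2 := congrArg (fun x => (g⁻¹).1 * x * g'.1) h
      simp only [proj, ← Matrix.mul_assoc] at h2
      rw [show (g⁻¹).1 * g.1 = 1 from g.inv_mul, Matrix.one_mul, Matrix.mul_assoc _ (g'⁻¹).1,
        show (g'⁻¹).1 * g'.1 = 1 from g'.inv_mul, Matrix.mul_one, Matrix.mul_assoc] at h2
      exact h2
    rw [← fromBlocks_toBlocks (g⁻¹ * g').1, fromBlocks_multiply, fromBlocks_multiply,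
      fromBlocks_inj] at h1
    obtain ⟨-, h12, h21, -⟩ := h1
    obtain ⟨W, A, D, -, -, hW, hg⟩ := exists_eq_shear_mul_diag (g := g⁻¹ * g')
      (A := (g⁻¹ * g').1.toBlocks₁₁) (B := 0) (D := (g⁻¹ * g').1.toBlocks₂₂) (by
        conv_lhs => rw [← fromBlocks_toBlocks (g⁻¹ * g').1]
        congr 1
        · simpa using h12
        · simpa using h21.symm)
    rw [Matrix.zero_mul] at hW
    rw [hW, shear_zero, one_mul] at hg
    exact ⟨A, D, hg.symm⟩
  · rintro ⟨A, D, h⟩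
    obtain rfl : g' = g * diag A D := by rw [h, mul_inv_cancel_left]
    have h1 : (diag A D).1 * fromBlocks 1 0 0 0 * ((diag A D)⁻¹).1 = fromBlocks 1 0 0 0 := by
      rw [diag_inv, diag_val, diag_val, fromBlocks_multiply, fromBlocks_multiply]
      simp only [Matrix.mul_zero, Matrix.zero_mul, add_zero, Matrix.mul_one]
      rw [show A.1 * (A⁻¹).1 = 1 from A.mul_inv]
    calc proj g = g.1 * ((diag A D).1 * fromBlocks 1 0 0 0 * ((diag A D)⁻¹).1) * (g⁻¹).1 := by
          rw [h1, proj]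
      _ = _ := by rw [proj, _root_.mul_inv_rev, Units.val_mul, Units.val_mul]; simp only [Matrix.mul_assoc]

/-- The sum of the principal minors of size `l`. -/
def sumMinors (M : Matrix m m S) (l : ℕ) : S :=
  ∑ s ∈ Finset.univ.powersetCard l, (M.submatrix (Subtype.val : s → m) (Subtype.val : s → m)).det

lemma map_sumMinors (f : S →+* T) (M : Matrix m m S) (l : ℕ) :
    f (sumMinors M l) = sumMinors (M.map f) l := by
  simp only [sumMinors, map_sum, RingHom.map_det]
  rfl

/-- Up to the unit `(-1) ^ l`, the sum of the principal minors is a coefficient of the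
characteristic polynomial. -/
lemma sumMinors_conj (g : GL m S) (M : Matrix m m S) {l : ℕ} (hl : l ≤ Fintype.card m) :
    sumMinors (g.1 * M * (g⁻¹).1) l = sumMinors M l := by
  have h1 := charpoly_coeff_eq_sum_minors (g.1 * M * (g⁻¹).1) l hl
  have h2 := charpoly_coeff_eq_sum_minors M l hl
  rw [show (g.1 * M * (g⁻¹).1).charpoly = M.charpoly by
    rw [Matrix.coe_units_inv]; exact charpoly_units_conj g M, h2] at h1
  exact ((isUnit_one.neg.pow l).mul_right_inj.1 h1).symm

lemma sumMinors_fromBlocks_one_zero :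
    sumMinors (fromBlocks 1 0 0 0 : Matrix (m ⊕ n) (m ⊕ n) S) (Fintype.card m) = 1 := by
  have h := charpoly_coeff_eq_sum_minors (fromBlocks 1 0 0 0 : Matrix (m ⊕ n) (m ⊕ n) S)
    (Fintype.card m) (by simp)
  rw [charpoly_fromBlocks_zero₁₂, charpoly_one, charpoly_zero, Fintype.card_sum,
    Nat.add_sub_cancel_left] at h
  have h2 : (((Polynomial.X : Polynomial S) - 1) ^ Fintype.card m *
      Polynomial.X ^ Fintype.card n).coeff (Fintype.card n) = (-1) ^ Fintype.card m := by
    have := Polynomial.coeff_mul_X_pow (((Polynomial.X : Polynomial S) - 1) ^ Fintype.card m)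
      (Fintype.card n) 0
    rw [zero_add] at this
    rw [this, Polynomial.coeff_zero_eq_eval_zero]
    simp
  rw [h2] at h
  exact ((isUnit_one.neg.pow _).mul_right_inj.1 ((mul_one _).trans h)).symm

lemma sumMinors_fromBlocks_zero_one :
    sumMinors (fromBlocks 0 0 0 1 : Matrix (m ⊕ n) (m ⊕ n) S) (Fintype.card n) = 1 := by
  have h := charpoly_coeff_eq_sum_minors (fromBlocks 0 0 0 1 : Matrix (m ⊕ n) (m ⊕ n) S)
    (Fintype.card n) (by simp)
  rw [charpoly_fromBlocks_zero₁₂, charpoly_one, charpoly_zero, Fintype.card_sum,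
    Nat.add_sub_cancel] at h
  have h2 : (Polynomial.X ^ Fintype.card m *
      ((Polynomial.X : Polynomial S) - 1) ^ Fintype.card n).coeff (Fintype.card m) =
        (-1) ^ Fintype.card n := by
    have := Polynomial.coeff_mul_X_pow (((Polynomial.X : Polynomial S) - 1) ^ Fintype.card n)
      (Fintype.card m) 0
    rw [zero_add] at this
    rw [mul_comm, this, Polynomial.coeff_zero_eq_eval_zero]
    simp
  rw [h2] at h
  exact ((isUnit_one.neg.pow _).mul_right_inj.1 ((mul_one _).trans h)).symm

/-- This and its analogue for `1 - proj g` express the ranks of image and kernel by polynomial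
identities, which therefore hold on the closed image of the quotient in affine space. -/
lemma sumMinors_proj (g : GL (m ⊕ n) S) : sumMinors (proj g) (Fintype.card m) = 1 := by
  rw [proj, sumMinors_conj _ _ (by simp), sumMinors_fromBlocks_one_zero]

lemma sumMinors_one_sub_proj (g : GL (m ⊕ n) S) :
    sumMinors (1 - proj g) (Fintype.card n) = 1 := by
  rw [one_sub_proj, sumMinors_conj _ _ (by simp), sumMinors_fromBlocks_zero_one]

/-- An idempotent matrix whose sums of principal minors are those of a projection of rank `n` with
kernel of rank `k` becomes conjugate to the standard projection on a Zariski cover. -/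
lemma exists_cover_proj_eq {R S : Type u} [CommRing R] [CommRing S] [Algebra R S] {n k : ℕ}
    (p : Matrix (Fin n ⊕ Fin k) (Fin n ⊕ Fin k) S) (hp : p * p = p) (hpn : sumMinors p n = 1)
    (hpk : sumMinors (1 - p) k = 1) :
    ∃ (S' : Type u) (_ : CommRing S') (_ : Algebra R S') (_ : Algebra S S')
      (_ : IsScalarTower R S S'),
      Module.FaithfullyFlat S S' ∧ Algebra.FinitePresentation S S' ∧
        ∃ g : GL (Fin n ⊕ Fin k) S', proj g = p.map (algebraMap S S') := by
  let ι := Fin n ⊕ Fin k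
  let I := {s // s ∈ (Finset.univ : Finset ι).powersetCard n} ×
    {t // t ∈ (Finset.univ : Finset ι).powersetCard k}
  let es : ∀ i : I, Fin n ≃ i.1.1 := fun i =>
    (i.1.1.equivFinOfCardEq (Finset.mem_powersetCard.1 i.1.2).2).symm
  let et : ∀ i : I, Fin k ≃ i.2.1 := fun i =>
    (i.2.1.equivFinOfCardEq (Finset.mem_powersetCard.1 i.2.2).2).symm
  -- `γ i` consists of `n` columns of `p` and `k` columns of `1 - p`: candidate bases of the image
  -- and the kernel. `η i` consists of the rows with the same indices.
  let γ : I → Matrix ι ι S := fun i => Matrix.of fun a b =>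
    Sum.elim (fun b => p a (es i b)) (fun b => (1 - p) a (et i b)) b
  let η : I → Matrix ι ι S := fun i => Matrix.of fun a b =>
    Sum.elim (fun a => p (es i a) b) (fun a => (1 - p) (et i a) b) a
  have hp1 : p * (1 - p) = 0 := by rw [Matrix.mul_sub, Matrix.mul_one, hp, sub_self]
  have hp2 : (1 - p) * p = 0 := by rw [Matrix.sub_mul, Matrix.one_mul, hp, sub_self]
  have hp3 : (1 - p) * (1 - p) = 1 - p := by
    rw [Matrix.sub_mul, Matrix.one_mul, hp1, sub_zero]
  have hηγ : ∀ i, η i * γ i = fromBlocks (p.submatrix (fun a => (es i a : ι)) (fun a => (es i a : ι)))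
      0 0 ((1 - p).submatrix (fun a => (et i a : ι)) (fun a => (et i a : ι))) := by
    intro i
    ext (a | a) (b | b)
    · exact congrFun (congrFun hp (es i a)) (es i b)
    · exact congrFun (congrFun hp1 (es i a)) (et i b)
    · exact congrFun (congrFun hp2 (et i a)) (es i b)
    · exact congrFun (congrFun hp3 (et i a)) (et i b)
  have hpγ : ∀ i, p * γ i = γ i * fromBlocks 1 0 0 0 := by
    intro i
    ext a (b | b)
    · rw [mul_apply, mul_apply, Fintype.sum_sum_type (f := fun j => γ i a j * _)]
      simp only [fromBlocks_apply₁₁, fromBlocks_apply₂₁, Matrix.zero_apply, mul_zero,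
        Finset.sum_const_zero, add_zero, one_apply, mul_ite, mul_one, Finset.sum_ite_eq',
        Finset.mem_univ, if_true]
      exact congrFun (congrFun hp a) (es i b)
    · rw [mul_apply, mul_apply, Fintype.sum_sum_type (f := fun j => γ i a j * _)]
      simp only [fromBlocks_apply₁₂, fromBlocks_apply₂₂, Matrix.zero_apply, mul_zero,
        Finset.sum_const_zero, add_zero]
      exact congrFun (congrFun hp1 a) (et i b)
  have hdet : ∀ i : I, (η i).det * (γ i).det =
      (p.submatrix (Subtype.val : i.1.1 → ι) Subtype.val).det *
        ((1 - p).submatrix (Subtype.val : i.2.1 → ι) Subtype.val).det := by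
    intro i
    rw [← det_mul, hηγ, det_fromBlocks_zero₂₁, ← det_submatrix_equiv_self (es i),
      ← det_submatrix_equiv_self (et i)]
    rfl
  -- The product of the determinants of `η i` and `γ i` is a principal minor of `p` times one of `1
  -- - p`. These products sum to `sumMinors p n * sumMinors (1 - p) k = 1`.
  have hspan : Ideal.span (Set.range fun i => (γ i).det) = ⊤ := by
    rw [Ideal.eq_top_iff_one]
    have h1 : (1 : S) = ∑ i : I, (η i).det * (γ i).det := by
      simp only [hdet]
      let d₁ : Finset ι → S := fun s => (p.submatrix (Subtype.val : s → ι) Subtype.val).det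
      let d₂ : Finset ι → S := fun t => ((1 - p).submatrix (Subtype.val : t → ι) Subtype.val).det
      show 1 = ∑ i : I, d₁ i.1.1 * d₂ i.2.1
      rw [Fintype.sum_prod_type' (f := fun (s : {s // s ∈ (Finset.univ : Finset ι).powersetCard n})
        (t : {t // t ∈ (Finset.univ : Finset ι).powersetCard k}) => d₁ s.1 * d₂ t.1),
        ← Fintype.sum_mul_sum, Finset.sum_coe_sort _ d₁, Finset.sum_coe_sort _ d₂]
      show 1 = sumMinors p n * sumMinors (1 - p) k
      rw [hpn, hpk, one_mul]
    rw [h1]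
    exact Ideal.sum_mem _ fun i _ => Ideal.mul_mem_left _ _ (Ideal.subset_span ⟨i, rfl⟩)
  let L : I → Type u := fun i => Localization.Away (γ i).det
  have hu : ∀ i, IsUnit ((γ i).map (algebraMap S (L i))) := by
    intro i
    rw [isUnit_iff_isUnit_det, ← RingHom.mapMatrix_apply, ← RingHom.map_det]
    exact IsLocalization.Away.algebraMap_isUnit _
  have hmulpi : ∀ A B : Matrix ι ι (∀ i, L i), ∀ i,
      (A * B).map (fun x => x i) = A.map (fun x => x i) * B.map (fun x => x i) := fun A B i =>
    Matrix.map_mul (f := Pi.evalRingHom L i)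
  have hextpi : ∀ A B : Matrix ι ι (∀ i, L i),
      (∀ i, A.map (fun x => x i) = B.map (fun x => x i)) → A = B := by
    intro A B h
    ext a b i
    exact congrFun (congrFun (h i) a) b
  have honepi : ∀ i, (1 : Matrix ι ι (∀ i, L i)).map (fun x => x i) = 1 := fun i =>
    Matrix.map_one (Pi.evalRingHom L i) (map_zero _) (map_one _)
  -- On each chart `γ i` is invertible and intertwines `p` with the standard projection; these
  -- matrices are assembled in the product ring.
  let g : GL ι (∀ i, L i) :=
    { val := Matrix.of fun a b i => algebraMap S (L i) (γ i a b)
      inv := Matrix.of fun a b i => ((hu i).unit⁻¹ : GL ι (L i)).1 a b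
      val_inv := by
        refine hextpi _ _ fun i => ?_
        rw [hmulpi, honepi]
        exact (hu i).unit.mul_inv
      inv_val := by
        refine hextpi _ _ fun i => ?_
        rw [hmulpi, honepi]
        exact (hu i).unit.inv_mul }
  refine ⟨∀ i, L i, inferInstance, inferInstance, inferInstance, inferInstance,
    Module.FaithfullyFlat.pi_localization _ hspan, inferInstance, g, ?_⟩
  have hg : g.1 * fromBlocks 1 0 0 0 = p.map (algebraMap S (∀ i, L i)) * g.1 := by
    refine hextpi _ _ fun i => ?_
    have h := congrArg (fun M : Matrix ι ι S => M.map (algebraMap S (L i))) (hpγ i)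
    simp only [Matrix.map_mul] at h
    rw [hmulpi, hmulpi]
    have h1 : (fromBlocks 1 0 0 0 : Matrix ι ι (∀ i, L i)).map (fun x => x i) =
        (fromBlocks 1 0 0 0 : Matrix ι ι S).map (algebraMap S (L i)) := by
      rw [fromBlocks_map, fromBlocks_map]
      congr 1 <;> ext a b <;> simp [one_apply, apply_ite (algebraMap S (L i)), ite_apply]
    rw [h1]
    exact h.symm
  rw [proj, hg, Matrix.mul_assoc, show g.1 * (g⁻¹).1 = 1 from g.mul_inv, Matrix.mul_one]

end Projection

end BlockGL

/-! ### The diagonal torus of the second block -/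

namespace BlockGL

/-- The embedding of diagonal matrices into the second block. -/
def lowerDiag (S : Type*) [CommRing S] (n k : ℕ) :
    (Fin k → Sˣ) →* Matrix.GeneralLinearGroup (Fin n ⊕ Fin k) S where
  toFun t := diag 1 (ofUnits t)
  map_one' := by
    rw [← diag_one]
    congr 1
  map_mul' t t' := by
    rw [diag_mul, one_mul]
    congr 1
    exact Units.ext (by simp [ofUnits_val])

lemma lowerDiag_apply {S : Type*} [CommRing S] {n k : ℕ} (t : Fin k → Sˣ) :
    lowerDiag S n k t = diag 1 (ofUnits t) := rfl

lemma map_lowerDiag {S T : Type*} [CommRing S] [CommRing T] (f : S →+* T) {n k : ℕ}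
    (t : Fin k → Sˣ) :
    Matrix.GeneralLinearGroup.map f (lowerDiag S n k t) =
      lowerDiag T n k fun i => Units.map f.toMonoidHom (t i) := by
  rw [lowerDiag_apply, map_diag, map_one, ofUnits_map, lowerDiag_apply]

lemma lowerDiag_inv_apply {S : Type*} [CommRing S] {n k : ℕ} (t : Fin k → Sˣ) (s : Fin k) :
    ((lowerDiag S n k t)⁻¹).1 (Sum.inr s) (Sum.inr s) = ((t s)⁻¹ : Sˣ) := by
  rw [lowerDiag_apply, diag_inv, diag_val, Matrix.fromBlocks_apply₂₂, ofUnits_inv, ofUnits_val,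
    Matrix.diagonal_apply_eq]
  rfl

end BlockGL

/-! ### The closed embedding of the quotient -/

namespace AffGrpScheme

open Matrix BlockGL

variable (R : Type u) [CommRing R]

lemma blockDiag_toHom {n k : ℕ} {S : Type u} [CommRing S] [Algebra R S] (A : GL (Fin n) S)
    (B : GL (Fin k) S) : (blockDiag R n k).toHom S (A, B) = BlockGL.diag A B :=
  Units.ext rfl

/-- The numbering of the entries of a square matrix of size `n + k`. -/
def entryEquiv (n k : ℕ) :
    Fin ((n + k) * (n + k)) ≃ (Fin n ⊕ Fin k) × (Fin n ⊕ Fin k) :=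
  finProdFinEquiv.symm.trans (Equiv.prodCongr finSumFinEquiv.symm finSumFinEquiv.symm)

/-- The universal projection. -/
def genProj (n k : ℕ) :
    Matrix (Fin n ⊕ Fin k) (Fin n ⊕ Fin k) (GLScheme R (Fin n ⊕ Fin k)).coord :=
  proj (GLScheme R (Fin n ⊕ Fin k)).gen

variable {R} in
lemma ev_genProj {n k : ℕ} {S : Type u} [CommRing S] [Algebra R S]
    (g : (GLScheme R (Fin n ⊕ Fin k)).Pt S) :
    (genProj R n k).map ((GLScheme R (Fin n ⊕ Fin k)).ev g) = proj (m := Fin n) (n := Fin k) g := by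
  have h := map_proj ((GLScheme R (Fin n ⊕ Fin k)).ev g).toRingHom
    (m := Fin n) (n := Fin k) (GLScheme R (Fin n ⊕ Fin k)).gen
  rw [show GeneralLinearGroup.map ((GLScheme R (Fin n ⊕ Fin k)).ev g).toRingHom
    (GLScheme R (Fin n ⊕ Fin k)).gen = g from map_ev_gen _ g] at h
  exact h

/-- The embedding of `GL_{n+k} / (GL_n × GL_k)` as the variety of projections of rank `n`. -/
def projEmbedding (n k : ℕ) : QuotientEmbedding (blockDiag R n k) ((n + k) * (n + k)) where
  φ j := genProj R n k (entryEquiv n k j).1 (entryEquiv n k j).2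
  eq_iff S _ _ g g' := by
    have h1 : (∀ j, (GLScheme R (Fin n ⊕ Fin k)).ev g
        (genProj R n k (entryEquiv n k j).1 (entryEquiv n k j).2) =
        (GLScheme R (Fin n ⊕ Fin k)).ev g'
          (genProj R n k (entryEquiv n k j).1 (entryEquiv n k j).2)) ↔
        proj (m := Fin n) (n := Fin k) g = proj (m := Fin n) (n := Fin k) g' := by
      rw [← ev_genProj, ← ev_genProj]
      constructor
      · intro h
        ext a b
        simpa using h ((entryEquiv n k).symm (a, b))
      · intro h j
        exact congrFun (congrFun h _) _
    refine h1.trans ((proj_eq_iff (m := Fin n) (n := Fin k) (S := S) g g').trans ?_)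
    constructor
    · rintro ⟨A, D, h⟩
      exact ⟨(A, D), (blockDiag_toHom R A D).trans h⟩
    · rintro ⟨⟨A, D⟩, h⟩
      exact ⟨A, D, (blockDiag_toHom R A D).symm.trans h⟩
  exists_lift S _ _ x hx := by
    let X : Matrix (Fin n ⊕ Fin k) (Fin n ⊕ Fin k) (MvPolynomial (Fin ((n + k) * (n + k))) R) :=
      Matrix.of fun a b => MvPolynomial.X ((entryEquiv n k).symm (a, b))
    let p : Matrix (Fin n ⊕ Fin k) (Fin n ⊕ Fin k) S :=
      Matrix.of fun a b => x ((entryEquiv n k).symm (a, b))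
    let φ : MvPolynomial (Fin ((n + k) * (n + k))) R →ₐ[R] (GLScheme R (Fin n ⊕ Fin k)).coord :=
      MvPolynomial.aeval fun j => genProj R n k (entryEquiv n k j).1 (entryEquiv n k j).2
    let ψ : MvPolynomial (Fin ((n + k) * (n + k))) R →ₐ[R] S := MvPolynomial.aeval x
    have hφ : X.map φ.toRingHom = genProj R n k := by
      ext a b
      simp [X, φ]
    have hψ : X.map ψ.toRingHom = p := by
      ext a b
      simp [X, ψ, p]
    have h1sub : ∀ {T : Type u} [CommRing T]
        (f : MvPolynomial (Fin ((n + k) * (n + k))) R →+* T), (1 - X).map f = 1 - X.map f := by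
      intro T _ f
      rw [← RingHom.mapMatrix_apply, map_sub, map_one]
      rfl
    -- Idempotence and the two conditions on minors are polynomial relations satisfied by the
    -- universal projection, so `x` satisfies them too; they are all that the local lifting needs.
    have hp : p * p = p := by
      ext a b
      have h := hx ((X * X) a b - X a b) (by
        show φ.toRingHom _ = 0
        rw [map_sub, sub_eq_zero]
        have : (X * X).map φ.toRingHom = X.map φ.toRingHom := by
          rw [Matrix.map_mul, hφ]
          exact proj_mul_self _
        exact congrFun (congrFun this a) b)
      have h' : ψ.toRingHom ((X * X) a b) = ψ.toRingHom (X a b) := by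
        rw [← sub_eq_zero, ← map_sub]
        exact h
      rw [← hψ, ← Matrix.map_mul]
      exact h'
    have hn : sumMinors p n = 1 := by
      have h := hx (sumMinors X n - 1) (by
        show φ.toRingHom _ = 0
        rw [map_sub, sub_eq_zero, map_sumMinors, hφ, map_one]
        simpa [genProj] using
          sumMinors_proj (m := Fin n) (n := Fin k) (GLScheme R (Fin n ⊕ Fin k)).gen)
      rw [← hψ, ← map_sumMinors, ← map_one ψ.toRingHom, ← sub_eq_zero, ← map_sub]
      exact h
    have hk : sumMinors (1 - p) k = 1 := by
      have h := hx (sumMinors (1 - X) k - 1) (by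
        show φ.toRingHom _ = 0
        rw [map_sub, sub_eq_zero, map_sumMinors, h1sub, hφ, map_one]
        simpa [genProj] using sumMinors_one_sub_proj (m := Fin n) (n := Fin k)
          (GLScheme R (Fin n ⊕ Fin k)).gen)
      rw [← hψ, ← h1sub, ← map_sumMinors, ← map_one ψ.toRingHom, ← sub_eq_zero, ← map_sub]
      exact h
    obtain ⟨S', _, _, _, hst, hff, hfp, g, hg⟩ := exists_cover_proj_eq (R := R) p hp hn hk
    refine ⟨S', _, _, _, hst, hff, hfp, g, fun j => ?_⟩
    have h := congrFun (congrFun ((ev_genProj (R := R) (n := n) (k := k) g).trans hg)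
      (entryEquiv n k j).1) (entryEquiv n k j).2
    simpa [p] using h

lemma coords_projEmbedding {n k : ℕ} {S : Type u} [CommRing S] [Algebra R S]
    (g : GL (Fin n ⊕ Fin k) S) (j : Fin ((n + k) * (n + k))) :
    (projEmbedding R n k).coords (QuotientGroup.mk (s := ((blockDiag R n k).toHom S).range) g) j =
      proj g (entryEquiv n k j).1 (entryEquiv n k j).2 :=
  congrFun (congrFun (ev_genProj (R := R) (n := n) (k := k) g) _) _

/-! ### Closed immersions -/

lemma GLScheme_comap_entry {ι : Type} [Fintype ι] [DecidableEq ι] {H : AffGrpScheme R}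
    (i : Hom H (GLScheme R ι)) (a b : ι) :
    (i.toHom H.coord H.gen : GL ι H.coord).1 a b =
      i.comap ((GLScheme R ι).gen.1 a b) := by
  have h := map_ev_gen (GLScheme R ι) (i.toHom H.coord H.gen)
  conv_lhs => rw [← h]
  rfl

lemma GLScheme_comap_entry_inv {ι : Type} [Fintype ι] [DecidableEq ι] {H : AffGrpScheme R}
    (i : Hom H (GLScheme R ι)) (a b : ι) :
    ((i.toHom H.coord H.gen)⁻¹ : GL ι H.coord).1 a b =
      i.comap (((GLScheme R ι).gen⁻¹ : GL ι _).1 a b) := by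
  have h := map_ev_gen (GLScheme R ι) (i.toHom H.coord H.gen)
  have h' := congrArg (fun g : GL ι H.coord => (g⁻¹).1 a b) h
  exact h'.symm

/-- The surjectivity criterion for all closed immersions below: the range has to contain the
variables and an inverse of `d`. -/
lemma mem_of_det_inv_mem {σ : Type} (d : MvPolynomial σ R)
    (A : Subalgebra R (Localization.Away d))
    (hX : ∀ s, algebraMap (MvPolynomial σ R) _ (MvPolynomial.X s) ∈ A)
    (hd : ∃ y ∈ A, algebraMap (MvPolynomial σ R) (Localization.Away d) d * y = 1) : A = ⊤ := by
  obtain ⟨y, hy, hdy⟩ := hd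
  have hpoly : ∀ p, algebraMap (MvPolynomial σ R) (Localization.Away d) p ∈ A := by
    intro p
    induction p using MvPolynomial.induction_on with
    | C a =>
      rw [← MvPolynomial.algebraMap_eq, ← IsScalarTower.algebraMap_apply]
      exact A.algebraMap_mem a
    | add p q hp hq => rw [map_add]; exact A.add_mem hp hq
    | mul_X p s hp => rw [map_mul]; exact A.mul_mem hp (hX s)
  rw [eq_top_iff]
  rintro z -
  obtain ⟨p, m, h⟩ := IsLocalization.Away.surj d z
  have hz : z = algebraMap _ _ m * y ^ p := by
    rw [← h, mul_assoc, ← mul_pow, hdy, one_pow, mul_one]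
  rw [hz]
  exact A.mul_mem (hpoly m) (A.pow_mem hy p)

/-- The torus of diagonal matrices with entries `1` in the first block. -/
def lowerTorus (n k : ℕ) : Hom (torus R k) (GLScheme R (Fin n ⊕ Fin k)) where
  toHom S _ _ := lowerDiag S n k
  naturality f t := (map_lowerDiag f.toRingHom t).symm

/-- The torus coordinates are diagonal entries of the matrix, their inverses diagonal entries of the
inverse matrix. -/
lemma lowerTorus_isClosedImmersion (n k : ℕ) : (lowerTorus R n k).IsClosedImmersion := by
  rw [Hom.IsClosedImmersion, ← AlgHom.range_eq_top]
  refine mem_of_det_inv_mem R _ _ (fun s => ?_) ?_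
  · refine ⟨_, (GLScheme_comap_entry R (lowerTorus R n k) (Sum.inr s) (Sum.inr s)).symm.trans ?_⟩
    show fromBlocks 1 0 0 (diagonal _) (Sum.inr s) (Sum.inr s) = _
    rw [fromBlocks_apply₂₂, diagonal_apply_eq]
    rfl
  · refine ⟨∏ s, (((lowerTorus R n k).toHom _ (torus R k).gen)⁻¹ :
      GL (Fin n ⊕ Fin k) (torus R k).coord).1 (Sum.inr s) (Sum.inr s),
      Subalgebra.prod_mem _ fun s _ => ⟨_, (GLScheme_comap_entry_inv R _ _ _).symm⟩, ?_⟩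
    rw [map_prod]
    refine (Finset.prod_mul_distrib.symm).trans (Finset.prod_eq_one fun s _ => ?_)
    let t : Fin k → (torus R k).coordˣ := (torus R k).gen
    refine (congrArg (fun y => (t s).1 * y) (lowerDiag_inv_apply (n := n) t s)).trans ?_
    exact (t s).mul_inv

lemma _root_.Matrix.det_mem_subalgebra {R S : Type*} [CommRing R] [CommRing S] [Algebra R S]
    {ι : Type*} [Fintype ι] [DecidableEq ι] (A : Subalgebra R S) (M : Matrix ι ι S)
    (h : ∀ a b, M a b ∈ A) : M.det ∈ A := by
  rw [det_apply]
  exact Subalgebra.sum_mem _ fun σ _ => by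
    rw [Units.smul_def]
    exact Subalgebra.zsmul_mem _ (Subalgebra.prod_mem _ fun i _ => h _ _) _

lemma GLScheme_subalgebra_eq_top {ι : Type} [Fintype ι] [DecidableEq ι]
    (A : Subalgebra R (GLScheme R ι).coord) (h : ∀ a b, (GLScheme R ι).gen.1 a b ∈ A)
    (h' : ∀ a b, ((GLScheme R ι).gen⁻¹ : GL ι (GLScheme R ι).coord).1 a b ∈ A) : A = ⊤ := by
  refine mem_of_det_inv_mem R _ _ (fun s => h s.1 s.2)
    ⟨((GLScheme R ι).gen⁻¹ : GL ι (GLScheme R ι).coord).1.det, Matrix.det_mem_subalgebra A _ h', ?_⟩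
  · let g : GL ι (GLScheme R ι).coord := (GLScheme R ι).gen
    have h1 : g.1.det * (g⁻¹).1.det = 1 := by
      rw [← det_mul, show g.1 * (g⁻¹).1 = 1 from g.mul_inv, det_one]
    have h2 : g.1.det = algebraMap (MvPolynomial (ι × ι) R) (GLCoord R ι)
        (Matrix.mvPolynomialX ι ι R).det := by
      rw [RingHom.map_det]
      rfl
    rw [h2] at h1
    exact h1

open scoped TensorProduct in
-- The range contains the entries of both blocks and of their inverses, hence both tensor factors.
lemma blockDiag_isClosedImmersion (n k : ℕ) : (blockDiag R n k).IsClosedImmersion := by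
  rw [Hom.IsClosedImmersion, ← AlgHom.range_eq_top]
  let H := (GLScheme R (Fin n)).prod (GLScheme R (Fin k))
  let A : Subalgebra R H.coord := (blockDiag R n k).comap.range
  let incl₁ : (GLScheme R (Fin n)).coord →ₐ[R] H.coord := Algebra.TensorProduct.includeLeft
  let incl₂ : (GLScheme R (Fin k)).coord →ₐ[R] H.coord := Algebra.TensorProduct.includeRight
  have hA : ∀ a b, ((blockDiag R n k).toHom H.coord H.gen : GL (Fin n ⊕ Fin k) H.coord).1 a b ∈ A :=
    fun a b => ⟨_, (GLScheme_comap_entry R (blockDiag R n k) a b).symm⟩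
  have hA' : ∀ a b,
      ((blockDiag R n k).toHom H.coord H.gen : GL (Fin n ⊕ Fin k) H.coord)⁻¹.1 a b ∈ A :=
    fun a b => ⟨_, (GLScheme_comap_entry_inv R (blockDiag R n k) a b).symm⟩
  have h1 : A.comap incl₁ = ⊤ := GLScheme_subalgebra_eq_top R _
    (fun a b => hA (Sum.inl a) (Sum.inl b)) (fun a b => hA' (Sum.inl a) (Sum.inl b))
  have h2 : A.comap incl₂ = ⊤ := GLScheme_subalgebra_eq_top R _
    (fun a b => hA (Sum.inr a) (Sum.inr b)) (fun a b => hA' (Sum.inr a) (Sum.inr b))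
  have h1' : ∀ x, incl₁ x ∈ A := fun x => by
    have : x ∈ A.comap incl₁ := by rw [h1]; trivial
    exact this
  have h2' : ∀ x, incl₂ x ∈ A := fun x => by
    have : x ∈ A.comap incl₂ := by rw [h2]; trivial
    exact this
  rw [eq_top_iff]
  rintro z -
  refine TensorProduct.induction_on (R := R) (M := (GLScheme R (Fin n)).coord)
    (N := (GLScheme R (Fin k)).coord) (motive := fun z => z ∈ A) z A.zero_mem (fun x y => ?_)
    (fun x y hx hy => A.add_mem hx hy)
  have h3 := Algebra.TensorProduct.tmul_mul_tmul (R := R) x (1 : (GLScheme R (Fin n)).coord)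
    (1 : (GLScheme R (Fin k)).coord) y
  rw [mul_one, one_mul] at h3
  rw [← h3]
  exact A.mul_mem (h1' x) (h2' y)

end AffGrpScheme

/-! ### The transporter schemes -/

namespace BlockGL

open Matrix

lemma mul_pairing_apply {S : Type*} [CommRing S] {n k : ℕ} {ι : Type*} (M : Matrix ι (Fin n) S)
    (i : ι) (j : Fin k) :
    (M * pairing S n k) i j = if h : j.val < n then M i ⟨j, h⟩ else 0 := by
  rw [mul_apply]
  simp only [pairing_apply, mul_ite, mul_one, mul_zero]
  split_ifs with h
  · rw [Finset.sum_eq_single ⟨j.val, h⟩]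
    · simp
    · intro l _ hl
      rw [if_neg (fun h => hl (Fin.ext h))]
    · simp
  · exact Finset.sum_eq_zero fun l _ => if_neg (by omega)

lemma pairing_mul_apply {S : Type*} [CommRing S] {n k : ℕ} {ι : Type*} (M : Matrix (Fin k) ι S)
    (i : Fin n) (j : ι) :
    (pairing S n k * M) i j = if h : i.val < k then M ⟨i, h⟩ j else 0 := by
  rw [mul_apply]
  simp only [pairing_apply, ite_mul, one_mul, zero_mul]
  split_ifs with h
  · rw [Finset.sum_eq_single ⟨i.val, h⟩]
    · simp
    · intro l _ hl
      rw [if_neg (fun h => hl (Fin.ext h.symm))]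
    · simp
  · exact Finset.sum_eq_zero fun l _ => if_neg (by omega)

lemma exists_diag_eq_iff {m n S : Type*} [Fintype m] [DecidableEq m] [Fintype n] [DecidableEq n]
    [CommRing S] (Z : GL (m ⊕ n) S) :
    (∃ (A : GL m S) (D : GL n S), diag A D = Z) ↔
      Z.1.toBlocks₁₂ = 0 ∧ Z.1.toBlocks₂₁ = 0 := by
  constructor
  · rintro ⟨A, D, rfl⟩
    exact ⟨rfl, rfl⟩
  · rintro ⟨h12, h21⟩
    obtain ⟨W, A, D, -, -, hW, hZ⟩ := exists_eq_shear_mul_diag (g := Z)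
      (A := Z.1.toBlocks₁₁) (B := 0) (D := Z.1.toBlocks₂₂) (by
        rw [← h12, ← h21]
        exact (fromBlocks_toBlocks Z.1).symm)
    rw [Matrix.zero_mul] at hW
    rw [hW, shear_zero, one_mul] at hZ
    exact ⟨A, D, hZ.symm⟩

section Transporter

variable {S T : Type*} [CommRing S] [CommRing T] {n k : ℕ} (p : S) (a b : Fin k → ℕ)

/-- Extension of a vector by zero, or its truncation. -/
def pad (n : ℕ) (b : Fin k → ℕ) (i : Fin n) : ℕ := if h : i.val < k then b ⟨i, h⟩ else 0

/-- The equations cutting out the matrices that carry one standard representative to another. -/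
def IsTransporter (M : Matrix (Fin n ⊕ Fin k) (Fin n ⊕ Fin k) S) : Prop :=
  M.toBlocks₂₁ = 0 ∧ ∀ i j,
    p ^ pad n b i * ((M.toBlocks₁₁ * pairing S n k) i j + p ^ a j * M.toBlocks₁₂ i j) =
      p ^ a j * (pairing S n k * M.toBlocks₂₂) i j

variable {p a b} in
-- With `Z = Y⁻¹ g X`, the identity `Y Z = g X` is solved block by block: `Z` has lower left block
-- `0` exactly when `g` does, its lower right block is then known, and vanishing of the upper right
-- block becomes the equations, cleared of denominators.
lemma isTransporter_iff (u : Sˣ) (g : GL (Fin n ⊕ Fin k) S) :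
    IsTransporter (u : S) a b g.1 ↔
      ∃ (A : GL (Fin n) S) (D : GL (Fin k) S), diag A D =
        (g * (diag 1 (ofUnits fun j => u ^ a j) * shear (pairing S n k)))⁻¹ *
          (diag 1 (ofUnits fun j => u ^ b j) * shear (pairing S n k)) := by
  set X := diag (1 : GL (Fin n) S) (ofUnits fun j => u ^ a j) * shear (pairing S n k)
  set Y := diag (1 : GL (Fin n) S) (ofUnits fun j => u ^ b j) * shear (pairing S n k)
  have hinv : (∃ (A : GL (Fin n) S) (D : GL (Fin k) S), diag A D = (g * X)⁻¹ * Y) ↔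
      ∃ (A : GL (Fin n) S) (D : GL (Fin k) S), diag A D = Y⁻¹ * (g * X) := by
    constructor
    · rintro ⟨A, D, h⟩
      exact ⟨A⁻¹, D⁻¹, by rw [← diag_inv, h]; group⟩
    · rintro ⟨A, D, h⟩
      exact ⟨A⁻¹, D⁻¹, by rw [← diag_inv, h]; group⟩
  rw [hinv, exists_diag_eq_iff]
  set Z := Y⁻¹ * (g * X)
  have hYZ : Y.1 * Z.1 = g.1 * X.1 := by
    rw [← Units.val_mul, ← Units.val_mul, mul_inv_cancel_left]
  have hX : X.1 = fromBlocks 1 (pairing S n k) 0 (diagonal fun j => (u : S) ^ a j) := by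
    simp only [X, Units.val_mul, diag_val, shear_val, ofUnits_val, fromBlocks_multiply]
    simp
  have hY : Y.1 = fromBlocks 1 (pairing S n k) 0 (diagonal fun j => (u : S) ^ b j) := by
    simp only [Y, Units.val_mul, diag_val, shear_val, ofUnits_val, fromBlocks_multiply]
    simp
  rw [hX, hY, ← fromBlocks_toBlocks Z.1, ← fromBlocks_toBlocks g.1, fromBlocks_multiply,
    fromBlocks_multiply, fromBlocks_inj] at hYZ
  obtain ⟨-, h12, h21, h22⟩ := hYZ
  simp only [Matrix.one_mul, Matrix.mul_one, Matrix.zero_mul, Matrix.mul_zero, zero_add,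
    add_zero] at h12 h21 h22
  have hZ21 : Z.1.toBlocks₂₁ = 0 ↔ g.1.toBlocks₂₁ = 0 := by
    constructor
    · intro h
      rw [← h21, h, Matrix.mul_zero]
    · intro h
      rw [h] at h21
      ext i j
      have := congrFun (congrFun h21 i) j
      rw [diagonal_mul] at this
      exact (Units.mul_right_eq_zero (u ^ b i)).1 (by simpa using this)
  rw [IsTransporter, hZ21, and_comm]
  refine and_congr_left fun h0 => ?_
  have hpad : ∀ i j, (u : S) ^ pad n b i * (pairing S n k * Z.1.toBlocks₂₂) i j =
      (u : S) ^ a j * (pairing S n k * g.1.toBlocks₂₂) i j := by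
    intro i j
    rw [pairing_mul_apply, pairing_mul_apply, pad]
    split_ifs with h
    · have := congrFun (congrFun h22 ⟨i, h⟩) j
      rw [h0, Matrix.zero_mul, zero_add, diagonal_mul, mul_diagonal] at this
      rw [this, mul_comm]
    · simp
  constructor
  · intro h
    ext i j
    have h1 := congrFun (congrFun h12 i) j
    rw [Matrix.add_apply, Matrix.add_apply, mul_diagonal, mul_comm (g.1.toBlocks₁₂ i j)] at h1
    have h2 := h i j
    rw [← h1, ← hpad, mul_add, add_eq_right] at h2
    exact (Units.mul_right_eq_zero (u ^ pad n b i)).1 (by simpa using h2)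
  · intro h i j
    have h1 := congrFun (congrFun h12 i) j
    rw [Matrix.add_apply, Matrix.add_apply, mul_diagonal, mul_comm (g.1.toBlocks₁₂ i j), h,
      Matrix.zero_apply, zero_add] at h1
    rw [← h1, hpad]

/-- At the slots satisfying this condition the equation of the transporter determines the entry of
the lower right block, at the others that of the upper left block. -/
def DeterminesLower (a b : Fin k → ℕ) (i : Fin n) (j : Fin k) : Prop :=
  n ≤ j.val ∨ a j < pad n b i

instance (i : Fin n) (j : Fin k) : Decidable (DeterminesLower a b i j) :=
  inferInstanceAs (Decidable (_ ∨ _))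

/-- The parametrization of the closure of the transporter by an affine space. -/
def transporter (v : Matrix (Fin n) (Fin n) S) (w : Matrix (Fin k) (Fin k) S) :
    Matrix (Fin n ⊕ Fin k) (Fin n ⊕ Fin k) S :=
  fromBlocks
    (Matrix.of fun i i' => if h : i'.val < k then
      if DeterminesLower a b i ⟨i', h⟩ then v i i'
      else p ^ (a ⟨i', h⟩ - pad n b i) * (pairing S n k * w) i ⟨i', h⟩ - p ^ a ⟨i', h⟩ * v i i'
      else v i i')
    (Matrix.of fun i j => if DeterminesLower a b i j then (pairing S n k * w) i j
      else (v * pairing S n k) i j)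
    0
    (Matrix.of fun j' j => if h : j'.val < n then
      if DeterminesLower a b ⟨j', h⟩ j then p ^ pad n b ⟨j', h⟩ * w j' j +
        p ^ (pad n b ⟨j', h⟩ - a j) * (v * pairing S n k) ⟨j', h⟩ j
      else w j' j
      else w j' j)

/-- The first block of parameters of a point of the transporter. -/
def upperParam (M : Matrix (Fin n ⊕ Fin k) (Fin n ⊕ Fin k) S) : Matrix (Fin n) (Fin n) S :=
  Matrix.of fun i i' => if h : i'.val < k then
    if DeterminesLower a b i ⟨i', h⟩ then M (Sum.inl i) (Sum.inl i')
    else M (Sum.inl i) (Sum.inr ⟨i', h⟩)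
    else M (Sum.inl i) (Sum.inl i')

/-- The second block of parameters of a point of the transporter. -/
def lowerParam (M : Matrix (Fin n ⊕ Fin k) (Fin n ⊕ Fin k) S) : Matrix (Fin k) (Fin k) S :=
  Matrix.of fun j' j => if h : j'.val < n then
    if DeterminesLower a b ⟨j', h⟩ j then M (Sum.inl ⟨j', h⟩) (Sum.inr j)
    else M (Sum.inr j') (Sum.inr j)
    else M (Sum.inr j') (Sum.inr j)

lemma map_transporter (f : S →+* T) (v : Matrix (Fin n) (Fin n) S) (w : Matrix (Fin k) (Fin k) S) :
    (transporter p a b v w).map f = transporter (f p) a b (v.map f) (w.map f) := by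
  have h1 : pairing T n k * w.map f = (pairing S n k * w).map f := by
    rw [Matrix.map_mul, pairing_map]
  have h2 : v.map f * pairing T n k = (v * pairing S n k).map f := by
    rw [Matrix.map_mul, pairing_map]
  rw [transporter, fromBlocks_map, transporter, h1, h2]
  congr 1
  · ext i i'
    simp only [map_apply, of_apply]
    split_ifs <;> simp
  · ext i j
    simp only [map_apply, of_apply]
    split_ifs <;> simp
  · ext i j
    simp
  · ext j' j
    simp only [map_apply, of_apply]
    split_ifs <;> simp

/-- In each slot the smaller of the exponents `a j` and `pad n b i` is split off, except that for `j
≥ n` the upper left term is absent and `p ^ a j` is. What remains is solved for one entry; the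
parameter freed by it stores the upper right entry. The identity holds for every `p`, invertible or
not. -/
lemma isTransporter_transporter (v : Matrix (Fin n) (Fin n) S) (w : Matrix (Fin k) (Fin k) S) :
    IsTransporter p a b (transporter p a b v w) := by
  refine ⟨rfl, fun i j => ?_⟩
  rw [mul_pairing_apply, pairing_mul_apply, transporter, toBlocks_fromBlocks₁₁,
    toBlocks_fromBlocks₁₂, toBlocks_fromBlocks₂₂]
  simp only [of_apply, j.2, i.2, dif_pos, Fin.eta]
  have hvw := pairing_mul_apply w i j
  have hvv := mul_pairing_apply v i j
  rw [hvw, hvv]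
  by_cases hL : DeterminesLower a b i j
  · simp only [if_pos hL]
    have hi : i.val < k := by
      rcases hL with h | h
      · have := i.2; have := j.2; omega
      · by_contra hi
        simp [pad, hi] at h
    simp only [dif_pos hi]
    by_cases hj : j.val < n
    · simp only [dif_pos hj]
      have hlt : a j < pad n b i := hL.resolve_left (by omega)
      have hpow : p ^ pad n b i = p ^ a j * p ^ (pad n b i - a j) := by
        rw [← pow_add]; congr 1; omega
      rw [hpow]
      ring
    · simp only [dif_neg hj]
      ring
  · simp only [if_neg hL]
    have hj : j.val < n := by
      by_contra h
      exact hL (Or.inl (by omega))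
    have hle : pad n b i ≤ a j := by
      by_contra h
      exact hL (Or.inr (by omega))
    simp only [dif_pos hj]
    have hpow : p ^ a j = p ^ pad n b i * p ^ (a j - pad n b i) := by
      rw [← pow_add]; congr 1; omega
    split_ifs
    · rw [hpow]
      ring
    · ring

/-- Each parameter is literally an entry of the matrix, which later makes the parametrization a
closed immersion. -/
lemma upperParam_transporter (v : Matrix (Fin n) (Fin n) S) (w : Matrix (Fin k) (Fin k) S) :
    upperParam a b (transporter p a b v w) = v := by
  ext i i'
  simp only [upperParam, transporter, of_apply, fromBlocks_apply₁₁, fromBlocks_apply₁₂]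
  split_ifs with h h1
  · rfl
  · rw [mul_pairing_apply, dif_pos i'.2]
  · rfl

lemma lowerParam_transporter (v : Matrix (Fin n) (Fin n) S) (w : Matrix (Fin k) (Fin k) S) :
    lowerParam a b (transporter p a b v w) = w := by
  ext j' j
  simp only [lowerParam, transporter, of_apply, fromBlocks_apply₂₂, fromBlocks_apply₁₂]
  split_ifs with h h1
  · rw [pairing_mul_apply, dif_pos j'.2]
  · rfl
  · rfl

variable {p a b} in
-- Invertibility of `p` is what allows cancelling the common power from each equation; so the
-- parametrized scheme and the transporter agree after inverting `π`.
lemma transporter_params (hp : IsUnit p) {M : Matrix (Fin n ⊕ Fin k) (Fin n ⊕ Fin k) S}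
    (hM : IsTransporter p a b M) :
    transporter p a b (upperParam a b M) (lowerParam a b M) = M := by
  obtain ⟨h21, h⟩ := hM
  have hL : ∀ (i : Fin n) (j : Fin k), DeterminesLower a b i j → i.val < k := by
    rintro i j (h | h)
    · have := i.2; have := j.2; omega
    · by_contra hi
      simp [pad, hi] at h
  have hU : ∀ (i : Fin n) (j : Fin k), ¬ DeterminesLower a b i j → j.val < n := by
    intro i j hn
    by_contra h
    exact hn (Or.inl (by omega))
  have h12 : ∀ i j, (if DeterminesLower a b i j then (pairing S n k * lowerParam a b M) i j
      else (upperParam a b M * pairing S n k) i j) = M (Sum.inl i) (Sum.inr j) := by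
    intro i j
    split_ifs with hd
    · rw [pairing_mul_apply, dif_pos (hL i j hd), lowerParam, of_apply, dif_pos i.2, if_pos hd]
    · rw [mul_pairing_apply, dif_pos (hU i j hd), upperParam, of_apply, dif_pos j.2, if_neg hd]
  have hw : ∀ (i : Fin n) (j : Fin k), ¬ DeterminesLower a b i j →
      (pairing S n k * lowerParam a b M) i j = (pairing S n k * M.toBlocks₂₂) i j := by
    intro i j hd
    rw [pairing_mul_apply, pairing_mul_apply]
    split_ifs with hi
    · rw [lowerParam, of_apply, dif_pos i.2, if_neg hd]
      rfl
    · rfl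
  have hv : ∀ (i : Fin n) (j : Fin k), DeterminesLower a b i j →
      (upperParam a b M * pairing S n k) i j = (M.toBlocks₁₁ * pairing S n k) i j := by
    intro i j hd
    rw [mul_pairing_apply, mul_pairing_apply]
    split_ifs with hj
    · rw [upperParam, of_apply, dif_pos j.2, if_pos hd]
      rfl
    · rfl
  ext (i | j') (i' | j)
  · rw [transporter, fromBlocks_apply₁₁, of_apply]
    split_ifs with hi' hd
    · rw [upperParam, of_apply, dif_pos hi', if_pos hd]
    · rw [hw i _ hd, upperParam, of_apply, dif_pos hi', if_neg hd]
      have hle : pad n b i ≤ a ⟨i', hi'⟩ := by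
        by_contra h
        exact hd (Or.inr (by omega))
      have hpow : p ^ a ⟨i', hi'⟩ = p ^ pad n b i * p ^ (a ⟨i', hi'⟩ - pad n b i) := by
        rw [← pow_add]; congr 1; omega
      have h1 := h i ⟨i', hi'⟩
      rw [mul_pairing_apply, dif_pos i'.2] at h1
      nth_rewrite 2 [hpow] at h1
      rw [mul_assoc (p ^ pad n b i)] at h1
      have h2 := (hp.pow _).mul_left_cancel h1
      rw [← h2]
      exact add_sub_cancel_right _ _
    · rw [upperParam, of_apply, dif_neg hi']
  · exact h12 i j
  · exact (congrFun (congrFun h21 j') i').symm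
  · rw [transporter, fromBlocks_apply₂₂, of_apply]
    split_ifs with hj' hd
    · rw [hv ⟨j', hj'⟩ j hd, lowerParam, of_apply, dif_pos hj', if_pos hd]
      have h1 := h ⟨j', hj'⟩ j
      rw [pairing_mul_apply, dif_pos j'.2] at h1
      by_cases hj : j.val < n
      · have hlt : a j < pad n b ⟨j', hj'⟩ := hd.resolve_left (by omega)
        have hpow : p ^ pad n b ⟨j', hj'⟩ = p ^ a j * p ^ (pad n b ⟨j', hj'⟩ - a j) := by
          rw [← pow_add]; congr 1; omega
        refine (hp.pow (a j)).mul_left_cancel (Eq.trans ?_ h1)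
        rw [hpow]
        simp only [toBlocks₁₂, of_apply]
        ring
      · rw [mul_pairing_apply, dif_neg hj] at h1 ⊢
        refine (hp.pow (a j)).mul_left_cancel (Eq.trans ?_ h1)
        simp only [toBlocks₁₂, of_apply]
        ring
    · rw [lowerParam, of_apply, dif_pos hj', if_neg hd]
    · rw [lowerParam, of_apply, dif_neg hj']

end Transporter

end BlockGL

namespace BlockGL

open Matrix

/-- The standard representatives of the double cosets. -/
def rep {S : Type*} [CommRing S] (n : ℕ) {k : ℕ} (u : Sˣ) (a : Fin k → ℕ) : GL (Fin n ⊕ Fin k) S :=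
  diag 1 (ofUnits fun j => u ^ a j) * shear (pairing S n k)

end BlockGL

namespace AffGrpScheme

open Matrix BlockGL

variable (R : Type u) [CommRing R]

/-! ### The standard points of the quotient -/

/-- The unipotent coset from which all standard points arise. -/
def basePt (n k : ℕ) : Coset (blockDiag R n k) R :=
  QuotientGroup.mk (s := ((blockDiag R n k).toHom R).range) (shear (pairing R n k))

/-- The standard points of the quotient. -/
def stdPt (π : R) (n : ℕ) {k : ℕ} (a : Fin k → ℕ) :
    Coset (blockDiag R n k) (Localization.Away π) :=
  piPow π (lowerTorus R n k) (fun j => (a j : ℤ)) •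
    Coset.map (blockDiag R n k) (Algebra.ofId R (Localization.Away π)) (basePt R n k)

/-- The image of `π` as a unit under an algebra homomorphism from `R[π⁻¹]`. -/
def piUnit {R : Type u} [CommRing R] {π : R} {S : Type u} [CommRing S] [Algebra R S]
    (ρ : Localization.Away π →ₐ[R] S) : Sˣ :=
  Units.map ρ.toRingHom.toMonoidHom
    (IsLocalization.Away.algebraMap_isUnit (S := Localization.Away π) π).unit

lemma piUnit_val {R : Type u} [CommRing R] {π : R} {S : Type u} [CommRing S] [Algebra R S]
    (ρ : Localization.Away π →ₐ[R] S) : (piUnit ρ : S) = algebraMap R S π :=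
  ρ.commutes π

lemma map_basePt {n k : ℕ} {S : Type u} [CommRing S] [Algebra R S] :
    Coset.map (blockDiag R n k) (Algebra.ofId R S) (basePt R n k) =
      QuotientGroup.mk (s := ((blockDiag R n k).toHom S).range) (shear (pairing S n k)) := by
  have h : GeneralLinearGroup.map (Algebra.ofId R S).toRingHom (shear (pairing R n k)) =
      shear (pairing S n k) := by rw [map_shear, pairing_map]
  rw [← h]
  rfl

lemma map_piPow {π : R} {n k : ℕ} {S : Type u} [CommRing S] [Algebra R S]
    (ρ : Localization.Away π →ₐ[R] S) (a : Fin k → ℕ) :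
    (GLScheme R (Fin n ⊕ Fin k)).map ρ (piPow π (lowerTorus R n k) fun j => (a j : ℤ)) =
      BlockGL.diag (1 : GL (Fin n) S) (ofUnits fun j => piUnit ρ ^ a j) := by
  refine (map_lowerDiag ρ.toRingHom _).trans ?_
  rw [lowerDiag_apply]
  congr 2
  funext j
  rw [zpow_natCast, map_pow]
  rfl

lemma map_stdPt {π : R} {n k : ℕ} {S : Type u} [CommRing S] [Algebra R S]
    (ρ : Localization.Away π →ₐ[R] S) (a : Fin k → ℕ) :
    Coset.map (blockDiag R n k) ρ (stdPt R π n a) =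
      QuotientGroup.mk (s := ((blockDiag R n k).toHom S).range) (rep n (piUnit ρ) a) := by
  rw [stdPt, map_basePt, rep, ← map_piPow]
  have h : GeneralLinearGroup.map ρ.toRingHom (shear (pairing (Localization.Away π) n k)) =
      shear (pairing S n k) := by rw [map_shear, pairing_map]
  rw [← h]
  refine congrArg (QuotientGroup.mk (s := ((blockDiag R n k).toHom S).range)) ?_
  exact map_mul (GeneralLinearGroup.map ρ.toRingHom) _ _

lemma smul_map_stdPt_eq_iff {π : R} {n k : ℕ} {S : Type u} [CommRing S] [Algebra R S]
    (ρ : Localization.Away π →ₐ[R] S) (a b : Fin k → ℕ)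
    (g : (GLScheme R (Fin n ⊕ Fin k)).Pt S) :
    g • Coset.map (blockDiag R n k) ρ (stdPt R π n a) =
        Coset.map (blockDiag R n k) ρ (stdPt R π n b) ↔
      IsTransporter (n := n) (k := k) (algebraMap R S π) a b
        (show GL (Fin n ⊕ Fin k) S from g).1 := by
  rw [map_stdPt, map_stdPt, ← piUnit_val ρ]
  refine Iff.trans ?_ (isTransporter_iff (piUnit ρ) _).symm
  refine (QuotientGroup.eq (s := ((blockDiag R n k).toHom S).range)).trans ?_
  constructor
  · rintro ⟨⟨A, D⟩, h⟩
    exact ⟨A, D, (blockDiag_toHom R A D).symm.trans h⟩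
  · rintro ⟨A, D, h⟩
    exact ⟨(A, D), (blockDiag_toHom R A D).trans h⟩

/-! ### Smoothness of the closures of the transporters -/

section Closure

variable (π : R) (n : ℕ) {k : ℕ} (a b : Fin k → ℕ)

/-- The variables of the affine space parametrizing the closure of a transporter. -/
abbrev TransVar (n k : ℕ) : Type := Fin n × Fin n ⊕ Fin k × Fin k

/-- The generic matrix in the closure of a transporter. -/
def genTransporter : Matrix (Fin n ⊕ Fin k) (Fin n ⊕ Fin k) (MvPolynomial (TransVar n k) R) :=
  transporter (algebraMap R _ π) a b
    (Matrix.of fun i j => MvPolynomial.X (Sum.inl (i, j)))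
    (Matrix.of fun i j => MvPolynomial.X (Sum.inr (i, j)))

/-- The coordinate ring of the closure of a transporter. -/
abbrev TransCoord : Type u := Localization.Away (genTransporter R π n a b).det

/-- The universal point of the closure of a transporter. -/
def transGen : GL (Fin n ⊕ Fin k) (TransCoord R π n a b) :=
  Matrix.GeneralLinearGroup.mk''
    ((genTransporter R π n a b).map (algebraMap _ (TransCoord R π n a b))) (by
      rw [← RingHom.mapMatrix_apply, ← RingHom.map_det]
      exact IsLocalization.Away.algebraMap_isUnit _)

lemma transGen_val : (transGen R π n a b).1 =
    (genTransporter R π n a b).map (algebraMap _ (TransCoord R π n a b)) := rfl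

lemma transGen_eq_transporter : (transGen R π n a b).1 =
    transporter (algebraMap R (TransCoord R π n a b) π) a b
      (Matrix.of fun i j => algebraMap (MvPolynomial (TransVar n k) R) _
        (MvPolynomial.X (Sum.inl (i, j))))
      (Matrix.of fun i j => algebraMap (MvPolynomial (TransVar n k) R) _
        (MvPolynomial.X (Sum.inr (i, j)))) := by
  refine (map_transporter _ a b (algebraMap (MvPolynomial (TransVar n k) R)
    (TransCoord R π n a b)) _ _).trans ?_
  rw [← IsScalarTower.algebraMap_apply]
  rfl

variable {R π n a b} in
lemma exists_map_transGen_eq {S : Type u} [CommRing S] [Algebra R S]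
    (hπ : IsUnit (algebraMap R S π)) (g : GL (Fin n ⊕ Fin k) S)
    (hg : IsTransporter (algebraMap R S π) a b g.1) :
    ∃ θ : TransCoord R π n a b →ₐ[R] S,
      GeneralLinearGroup.map θ.toRingHom (transGen R π n a b) = g := by
  let v : TransVar n k → S :=
    Sum.elim (fun s => upperParam a b g.1 s.1 s.2) (fun s => lowerParam a b g.1 s.1 s.2)
  have hv : (genTransporter R π n a b).map (MvPolynomial.aeval (R := R) v).toRingHom = g.1 := by
    rw [genTransporter, map_transporter]
    conv_rhs => rw [← transporter_params hπ hg]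
    congr 1
    · exact (MvPolynomial.aeval (R := R) v).commutes π
    · ext i j
      simp [v]
    · ext i j
      simp [v]
  obtain ⟨θ, hθ, -⟩ := existsUnique_algHom_away (R := R) (genTransporter R π n a b).det v (by
    have h : MvPolynomial.aeval (R := R) v (genTransporter R π n a b).det = g.1.det := by
      rw [← hv]
      exact RingHom.map_det (MvPolynomial.aeval (R := R) v).toRingHom _
    rw [h]
    exact (Matrix.isUnit_iff_isUnit_det _).1 g.isUnit)
  refine ⟨θ, Units.ext ?_⟩
  have hcomp : θ.comp (IsScalarTower.toAlgHom R (MvPolynomial (TransVar n k) R)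
      (TransCoord R π n a b)) = MvPolynomial.aeval v :=
    MvPolynomial.algHom_ext fun s => by simpa using hθ s
  rw [← hv]
  ext x y
  exact AlgHom.congr_fun hcomp (genTransporter R π n a b x y)

/-- A localization of a polynomial ring is flat over `R`, so `π` remains a nonzerodivisor. -/
lemma isSMulRegular_transCoord (hπ : IsSMulRegular R π) {x : TransCoord R π n a b}
    (hx : algebraMap R (TransCoord R π n a b) π * x = 0) : x = 0 := by
  have : Module.Flat (MvPolynomial (TransVar n k) R) (TransCoord R π n a b) :=
    IsLocalization.flat _ (Submonoid.powers (genTransporter R π n a b).det)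
  have : Module.Flat R (TransCoord R π n a b) := Module.Flat.trans R (MvPolynomial (TransVar n k) R) _
  have h := IsSMulRegular.of_flat (S := TransCoord R π n a b) hπ
  exact h.right_eq_zero_of_smul hx

/-- The homomorphism of coordinate rings given by the universal point of the closure of a
transporter. -/
def transComap : (GLScheme R (Fin n ⊕ Fin k)).coord →ₐ[R] TransCoord R π n a b :=
  (GLScheme R (Fin n ⊕ Fin k)).ev (transGen R π n a b)

lemma map_transComap_gen : (GLScheme R (Fin n ⊕ Fin k)).map (transComap R π n a b)
    (GLScheme R (Fin n ⊕ Fin k)).gen = transGen R π n a b :=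
  map_ev_gen _ _

lemma transComap_surjective : Function.Surjective (transComap R π n a b) := by
  rw [← AlgHom.range_eq_top]
  set A := (transComap R π n a b).range
  have hA : ∀ x y, (transGen R π n a b).1 x y ∈ A := fun x y =>
    ⟨(GLScheme R (Fin n ⊕ Fin k)).gen.1 x y,
      congrArg (fun g : GL (Fin n ⊕ Fin k) (TransCoord R π n a b) => g.1 x y)
        (map_transComap_gen R π n a b)⟩
  have hA' : ∀ x y, ((transGen R π n a b)⁻¹).1 x y ∈ A := fun x y =>
    ⟨((GLScheme R (Fin n ⊕ Fin k)).gen⁻¹ : GL (Fin n ⊕ Fin k) _).1 x y,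
      congrArg (fun g : GL (Fin n ⊕ Fin k) (TransCoord R π n a b) => (g⁻¹).1 x y)
        (map_transComap_gen R π n a b)⟩
  refine mem_of_det_inv_mem R _ _ ?_ ⟨((transGen R π n a b)⁻¹).1.det,
    Matrix.det_mem_subalgebra A _ hA', ?_⟩
  · have hval := transGen_eq_transporter R π n a b
    rintro (⟨i, j⟩ | ⟨i, j⟩)
    · have h := congrFun (congrFun (congrArg (upperParam a b) hval) i) j
      rw [upperParam_transporter] at h
      rw [of_apply] at h
      rw [← h, upperParam, of_apply]
      split_ifs <;> exact hA _ _
    · have h := congrFun (congrFun (congrArg (lowerParam a b) hval) i) j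
      rw [lowerParam_transporter] at h
      rw [of_apply] at h
      rw [← h, lowerParam, of_apply]
      split_ifs <;> exact hA _ _
  · rw [RingHom.map_det, RingHom.mapMatrix_apply, ← transGen_val, ← det_mul,
      show (transGen R π n a b).1 * ((transGen R π n a b)⁻¹).1 = 1 from
        (transGen R π n a b).mul_inv, det_one]

/-- Every point of the transporter factors through the parametrized scheme. Conversely, a function
vanishing on the transporter vanishes at the universal point after inverting `π`, and hence already
before, since `π` is a nonzerodivisor there. -/
lemma closureIdeal_stdPt (hπ : IsSMulRegular R π) :
    closureIdeal π (blockDiag R n k) (stdPt R π n a) (stdPt R π n b) =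
      RingHom.ker (transComap R π n a b) := by
  ext f
  constructor
  · intro hf
    let Q := TransCoord R π n a b
    let S := Localization.Away (algebraMap R Q π)
    have hu : IsUnit (algebraMap R S π) := by
      rw [IsScalarTower.algebraMap_apply R Q S]
      exact IsLocalization.Away.algebraMap_isUnit _
    let ρ : Localization.Away π →ₐ[R] S :=
      IsLocalization.liftAlgHom (M := Submonoid.powers π) (f := Algebra.ofId R S) (by
        rintro ⟨_, m, rfl⟩
        simpa [Algebra.ofId_apply] using hu.pow m)
    let j : Q →ₐ[R] S := IsScalarTower.toAlgHom R Q S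
    have hj : Function.Injective j := by
      refine IsLocalization.injective S (M := Submonoid.powers (algebraMap R Q π)) ?_
      refine Submonoid.powers_le.2 (mem_nonZeroDivisors_iff_right.2 fun x hx => ?_)
      exact isSMulRegular_transCoord R π n a b hπ (by rw [mul_comm]; exact hx)
    let g : (GLScheme R (Fin n ⊕ Fin k)).Pt S :=
      GeneralLinearGroup.map j.toRingHom (transGen R π n a b)
    have hg : IsTransporter (algebraMap R S π) a b
        (GeneralLinearGroup.map j.toRingHom (transGen R π n a b)).1 := by
      have h : (GeneralLinearGroup.map j.toRingHom (transGen R π n a b)).1 =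
          (transGen R π n a b).1.map j.toRingHom := rfl
      rw [h, transGen_eq_transporter, map_transporter, show j.toRingHom (algebraMap R Q π) = algebraMap R S π from
          j.commutes π]
      exact isTransporter_transporter _ _ _ _ _
    have h0 := hf S ρ g ((smul_map_stdPt_eq_iff R ρ a b g).2 hg)
    have hev : j.comp (transComap R π n a b) = (GLScheme R (Fin n ⊕ Fin k)).ev g := by
      apply ev_unique
      rw [map_comp, map_transComap_gen]
      rfl
    rw [← hev] at h0
    exact hj (h0.trans (map_zero j).symm)
  · intro hf S _ _ ρ g hg
    rw [smul_map_stdPt_eq_iff] at hg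
    obtain ⟨θ, hθ⟩ := exists_map_transGen_eq (by rw [← piUnit_val ρ]; exact Units.isUnit _) _ hg
    have hev : θ.comp (transComap R π n a b) = (GLScheme R (Fin n ⊕ Fin k)).ev g := by
      apply ev_unique
      rw [map_comp, map_transComap_gen]
      exact hθ
    rw [← hev]
    exact (congrArg θ hf).trans (map_zero θ)

/-- The closure is a principal open subscheme of an affine space over `R`. -/
theorem smooth_closureIdeal_stdPt (hπ : IsSMulRegular R π) :
    Algebra.Smooth R ((GLScheme R (Fin n ⊕ Fin k)).coord ⧸
      closureIdeal π (blockDiag R n k) (stdPt R π n a) (stdPt R π n b)) := by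
  rw [closureIdeal_stdPt R π n a b hπ]
  have h1 : Algebra.Smooth R (MvPolynomial (TransVar n k) R) := {}
  have h2 : Algebra.Smooth (MvPolynomial (TransVar n k) R) (TransCoord R π n a b) :=
    Algebra.Smooth.of_isLocalization_Away (genTransporter R π n a b).det
  have h3 : Algebra.Smooth R (TransCoord R π n a b) :=
    Algebra.Smooth.comp R (MvPolynomial (TransVar n k) R) (TransCoord R π n a b)
  exact Algebra.Smooth.of_equiv
    (Ideal.quotientKerAlgEquivOfSurjective (transComap_surjective R π n a b)).symm

end Closure

end AffGrpScheme

/-! ### Valuations -/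

namespace RelLocalField

variable {R : Type u} [CommRing R] {π : R} (E : RelLocalField R π)

lemma valuation_pi : IsNonarchimedeanLocalField.valueGroupWithZeroIsoInt E.F
    (valuation E.F (algebraMap R E.F π)) = WithZero.exp (-1 : ℤ) := by
  let φ := IsNonarchimedeanLocalField.valueGroupWithZeroIsoInt E.F
  have hI := Valuation.integer.integers (valuation E.F)
  have hne : valuation E.F (algebraMap R E.F π) ≠ 0 :=
    (Valuation.ne_zero_iff _).2 E.isUnit_algebraMap.ne_zero
  have hlt : valuation E.F (algebraMap R E.F π) < 1 := by
    refine lt_of_le_of_ne (E.toInt π).2 fun h => E.irreducible.not_isUnit ?_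
    exact hI.isUnit_iff_valuation_eq_one.2 h
  have h1 : φ (valuation E.F (algebraMap R E.F π)) < 1 := by
    rw [← map_one φ]
    exact (OrderIso.lt_iff_lt φ.toOrderIso).2 hlt
  -- An element of normalized valuation `1` lies in the maximal ideal, so `π` divides it; this
  -- bounds the valuation of `π` from above.
  obtain ⟨y, hy⟩ := φ.surjective (WithZero.exp (-1 : ℤ))
  obtain ⟨x, rfl⟩ := ValuativeRel.valuation_surjective y
  have hy : φ (valuation E.F x) = WithZero.exp (-1 : ℤ) := hy
  have hx : valuation E.F x < 1 := by
    refine (OrderIso.lt_iff_lt φ.toOrderIso).1 ?_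
    show φ _ < φ _
    rw [hy, map_one, ← WithZero.exp_zero, WithZero.exp_lt_exp]
    norm_num
  have hxle : valuation E.F x ≤ valuation E.F (algebraMap R E.F π) := by
    have hxm : (⟨x, hx.le⟩ : E.O) ∈ IsLocalRing.maximalIdeal E.O := fun hu =>
      hx.ne (hI.isUnit_iff_valuation_eq_one.1 hu)
    rw [E.irreducible.maximalIdeal_eq, Ideal.mem_span_singleton] at hxm
    exact hI.le_of_dvd hxm
  have h2 : WithZero.exp (-1 : ℤ) ≤ φ (valuation E.F (algebraMap R E.F π)) := by
    rw [← hy]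
    exact (OrderIso.le_iff_le φ.toOrderIso).2 hxle
  have h0 : φ (valuation E.F (algebraMap R E.F π)) ≠ 0 := by
    rw [← map_zero φ]
    exact fun h => hne (φ.injective h)
  show φ _ = _
  rw [← WithZero.exp_log h0] at h1 h2 ⊢
  rw [WithZero.exp_le_exp] at h2
  rw [← WithZero.exp_zero, WithZero.exp_lt_exp] at h1
  congr 1
  omega

lemma val_zero : E.val 0 = ⊤ := if_pos rfl

lemma val_neg_inv_pow (m : ℕ) :
    E.val (-(algebraMap R E.F π)⁻¹ ^ m) = ((-m : ℤ) : WithTop ℤ) := by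
  have hne : -(algebraMap R E.F π)⁻¹ ^ m ≠ 0 :=
    neg_ne_zero.2 (pow_ne_zero _ (inv_ne_zero E.isUnit_algebraMap.ne_zero))
  rw [val, if_neg hne, Valuation.map_neg, map_pow, map_inv₀, map_pow, map_inv₀, valuation_pi,
    WithZero.log_pow, WithZero.log_inv, WithZero.log_exp]
  simp

lemma val_one : E.val 1 = 0 := by
  rw [val, if_neg one_ne_zero, map_one, map_one, WithZero.log_one]
  rfl

end RelLocalField

namespace BlockGL

open Matrix

lemma rep_val {S : Type*} [CommRing S] {n k : ℕ} (u : Sˣ) (a : Fin k → ℕ) :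
    (rep n u a).1 = fromBlocks 1 (pairing S n k) 0 (diagonal fun j => (u : S) ^ a j) := by
  simp only [rep, Units.val_mul, diag_val, shear_val, ofUnits_val, fromBlocks_multiply]
  simp

/-- The coordinates of a standard point are `0`, `1` and negated powers of `u⁻¹`; their valuations
depend only on the exponents. -/
lemma proj_rep {F : Type*} [Field F] {n k : ℕ} (u : Fˣ) (a : Fin k → ℕ) :
    proj (rep n u a) = fromBlocks 1
      (Matrix.of fun i j => if i.val = j.val then -(u : F)⁻¹ ^ a j else 0) 0 0 := by
  have h : (rep n u a).1 * fromBlocks 1 0 0 0 = fromBlocks 1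
      (Matrix.of fun i j => if i.val = j.val then -(u : F)⁻¹ ^ a j else 0) 0 0 *
        (rep n u a).1 := by
    rw [rep_val, fromBlocks_multiply, fromBlocks_multiply]
    congr 1
    · simp
    · ext i j
      simp only [Matrix.one_mul, Matrix.mul_zero, add_zero, Matrix.add_apply, mul_diagonal, of_apply,
        pairing_apply, Matrix.zero_apply]
      split_ifs
      · simp
      · simp
    · simp
    · simp
  rw [proj, h, Matrix.mul_assoc, show (rep n u a).1 * ((rep n u a)⁻¹).1 = 1 from
    (rep n u a).mul_inv, Matrix.mul_one]

end BlockGL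

/-! ### The main theorem -/

namespace AffGrpScheme

open Matrix BlockGL

variable {R : Type u} [CommRing R] {π : R}

lemma valMin_stdPt {n k : ℕ} (a : Fin k → ℕ) (E E' : RelLocalField R π) :
    E.valMin ((projEmbedding R n k).coords
        (Coset.map (blockDiag R n k) E.ofAway (stdPt R π n a))) =
      E'.valMin ((projEmbedding R n k).coords
        (Coset.map (blockDiag R n k) E'.ofAway (stdPt R π n a))) := by
  have key : ∀ x y, E.val (proj (rep n (piUnit E.ofAway) a) x y) =
      E'.val (proj (rep n (piUnit E'.ofAway) a) x y) := by
    intro x y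
    rw [proj_rep, proj_rep, piUnit_val, piUnit_val]
    rcases x with x | x <;> rcases y with y | y
    · rw [fromBlocks_apply₁₁, fromBlocks_apply₁₁, one_apply, one_apply]
      split_ifs
      · rw [E.val_one, E'.val_one]
      · rw [E.val_zero, E'.val_zero]
    · rw [fromBlocks_apply₁₂, fromBlocks_apply₁₂, of_apply, of_apply]
      split_ifs
      · rw [E.val_neg_inv_pow, E'.val_neg_inv_pow]
      · rw [E.val_zero, E'.val_zero]
    · exact E.val_zero.trans E'.val_zero.symm
    · exact E.val_zero.trans E'.val_zero.symm
  rw [map_stdPt, map_stdPt]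
  refine Finset.inf_congr rfl fun j _ => ?_
  rw [coords_projEmbedding, coords_projEmbedding]
  exact key _ _

lemma exists_eq_smul_stdPt {n k : ℕ} (E : RelLocalField R π) (z : Coset (blockDiag R n k) E.F) :
    ∃ a : Fin k → ℕ, (∀ j, n ≤ j.val → a j = 0) ∧ ∃ c ∈ E.K₀ (GLScheme R (Fin n ⊕ Fin k)),
      z = c • Coset.map (blockDiag R n k) E.ofAway (stdPt R π n a) := by
  obtain ⟨g, rfl⟩ := QuotientGroup.mk_surjective (s := ((blockDiag R n k).toHom E.F).range) z
  obtain ⟨a, c, A, B, ha, hg⟩ := exists_eq_integral_mul_representative_mul_diag (O := E.O)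
    (F := E.F) E.irreducible (piUnit E.ofAway) (piUnit_val E.ofAway) (n := n) (k := k) g
  refine ⟨a, ha, GeneralLinearGroup.map (algebraMap E.O E.F) c, ⟨c, rfl⟩, ?_⟩
  rw [map_stdPt]
  refine Eq.symm ((QuotientGroup.eq (s := ((blockDiag R n k).toHom E.F).range)).2 ⟨(A, B), ?_⟩)
  rw [hg]
  exact (blockDiag_toHom R A B).trans (inv_mul_cancel_left (GeneralLinearGroup.map
    (algebraMap E.O E.F) c * rep n (piUnit E.ofAway) a) (BlockGL.diag A B)).symm

lemma exists_congruent_smul_eq {n k : ℕ} (E : RelLocalField R π) {l : ℕ} (hl : 0 < l)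
    (a : Fin k → ℕ) (ha : ∀ j, n ≤ j.val → a j = 0)
    (c : (GLScheme R (Fin n ⊕ Fin k)).Pt E.F) (hc : c ∈ E.K (GLScheme R (Fin n ⊕ Fin k)) l) :
    ∃ c' ∈ E.K (GLScheme R (Fin n ⊕ Fin k)) l,
      ((GLScheme R (Fin n ⊕ Fin k)).map E.ofAway
          (piPow π (lowerTorus R n k) fun j => (a j : ℤ)) * c) •
        Coset.map (blockDiag R n k) (Algebra.ofId R E.F) (basePt R n k) =
      (c' * (GLScheme R (Fin n ⊕ Fin k)).map E.ofAway
          (piPow π (lowerTorus R n k) fun j => (a j : ℤ))) •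
        Coset.map (blockDiag R n k) (Algebra.ofId R E.F) (basePt R n k) := by
  obtain ⟨c, hc, rfl⟩ := hc
  obtain ⟨c', A, B, hc', h⟩ := exists_congruent_mul_representative_mul_diag (O := E.O) (F := E.F)
    -- Positivity of `l` puts this ideal inside the maximal ideal, so matrices congruent to `1` are
    -- invertible. No other bound is needed, whence `l₀ = 0`.
    (I := IsLocalRing.maximalIdeal E.O ^ l) (Ideal.pow_le_self hl.ne') (n := n) (k := k)
    (fun j => piUnit E.ofAway ^ a j) (fun j => E.toInt π ^ a j)
    (fun j => by rw [Units.val_pow_eq_pow_val, piUnit_val, map_pow]; rfl)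
    (fun j hj => by rw [ha j hj, pow_zero]) c hc
  refine ⟨GeneralLinearGroup.map (algebraMap E.O E.F) c', ⟨c', hc', rfl⟩, ?_⟩
  rw [map_basePt, map_piPow]
  refine Eq.symm ((QuotientGroup.eq (s := ((blockDiag R n k).toHom E.F).range)).2 ⟨(A, B), ?_⟩)
  refine (blockDiag_toHom R A B).trans ?_
  rw [← mul_assoc (GeneralLinearGroup.map (algebraMap E.O E.F) c')] at h
  exact eq_inv_mul_of_mul_eq h.symm

end AffGrpScheme

end

theorem mainTheorem7 (R : Type u) [CommRing R] [IsRegularLocalRing R]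
    [IsAdicComplete (IsLocalRing.maximalIdeal R) R]
    (h2 : ringChar (IsLocalRing.ResidueField R) ≠ 2)
    (π : R) (hπ : π ∈ IsLocalRing.maximalIdeal R) (hπ2 : π ∉ IsLocalRing.maximalIdeal R ^ 2)
    (n k : ℕ) :
    AffGrpScheme.IsUniformSpherical π (AffGrpScheme.blockDiag R n k) := by
  have hdom : IsDomain R := IsRegularLocalRing.isDomain R
  have hπ0 : π ≠ 0 := fun h => hπ2 (h ▸ Ideal.zero_mem _)
  have hreg : IsSMulRegular R π := IsSMulRegular.of_ne_zero hπ0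
  -- The coweights are nonnegative, so that the torus contracts lower shears, and vanish from index
  -- `n` on, so that it commutes with the part of the upper shears not absorbed by the pairing.
  refine ⟨AffGrpScheme.blockDiag_isClosedImmersion R n k, k, AffGrpScheme.lowerTorus R n k, _,
    AffGrpScheme.projEmbedding R n k, {AffGrpScheme.basePt R n k},
    {α | ∃ a : Fin k → ℕ, (∀ j, n ≤ j.val → a j = 0) ∧ α = fun j => (a j : ℤ)},
    AffGrpScheme.lowerTorus_isClosedImmersion R n k, Set.finite_singleton _, ?_, ?_, ?_, 0, ?_⟩
  · intro E z
    obtain ⟨a, ha, c, hc, hz⟩ := AffGrpScheme.exists_eq_smul_stdPt E z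
    exact ⟨AffGrpScheme.stdPt R π n a, ⟨_, ⟨a, ha, rfl⟩, _, rfl, rfl⟩, c, hc, hz⟩
  · rintro _ ⟨_, ⟨a, -, rfl⟩, _, rfl, rfl⟩ _ ⟨_, ⟨b, -, rfl⟩, _, rfl, rfl⟩
    exact AffGrpScheme.smooth_closureIdeal_stdPt R π n a b hreg
  · rintro _ ⟨_, ⟨a, -, rfl⟩, _, rfl, rfl⟩ E E'
    exact AffGrpScheme.valMin_stdPt a E E'
  · rintro l hl E _ rfl _ ⟨a, ha, rfl⟩
    ext z
    constructor
    · rintro ⟨c, hc, c', hc', rfl⟩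
      obtain ⟨c'', hc'', h⟩ := AffGrpScheme.exists_congruent_smul_eq E hl a ha c' hc'
      refine ⟨c * c'', mul_mem hc hc'', ?_⟩
      rw [mul_assoc, mul_smul, h, ← mul_smul, mul_assoc]
    · rintro ⟨c, hc, rfl⟩
      exact ⟨c, hc, 1, one_mem _, by rw [mul_one]⟩
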